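/- Let $n>1$. Consider compressible fluid flow on $\mathbb R^n$ with velocity $\mathbf u$, density $\rho>0$ and entropy $S$, $$\partial_t\mathbf u+\mathbf u\cdot\nabla\mathbf u+\tfrac1\rho\nabla p=0,\qquad \partial_t\rho+\nabla\cdot(\rho\mathbf u)=0,\qquad \partial_t S+\mathbf u\cdot\nabla S=0,\qquad p=P(\rho,S),$$ with $P$ smooth on $\rho>0$. The equation of state is called non-isentropic if $\partial P/\partial S\not\equiv0$ on $(0,\infty)\times I$ for every nonempty open interval $I$ of entropy values. In the isentropic case the entropy is constant, the system is the one for $(\mathbf u,\rho)$ with $p=P(\rho)$, $P$ smooth and not constant, and $S$ is dropped from all functions below. Let $\omega^{ij}=\frac12(\partial_ju^i-\partial_iu^j)$. The vorticity is the scalar $\varpi=\epsilon^{i_1j_1\cdots i_mj_m}\omega_{i_1j_1}\cdots\omega_{i_mj_m}$ if $n=2m$, and the vector $\boldsymbol\varpi$ with components $\varpi^i=\epsilon^{ij_1k_1\cdots j_mk_m}\omega_{j_1k_1}\cdots\omega_{j_mk_m}$ if $n=2m+1$, where $\epsilon$ is the totally antisymmetric tensor. A smooth density of vorticity form is a smooth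 function $T(\rho,S,\mathbf u,\varpi)$, respectively $T(\rho,S,\mathbf u,\boldsymbol\varpi)$. It is conserved on domains $V(t)$ moving with the fluid, $\frac{d}{dt}\int_{V(t)}T\,d^nx=0$ formally for all solutions, when $$\mathcal D_tT+D_{\mathbf x}\cdot(\mathbf uT)=0$$ holds identically for all smooth fields with $\rho>0$, where $D_{\mathbf x}$ is the total spatial derivative and $\mathcal D_t$ is the total time derivative with all time derivatives of the fields eliminated by the equations of motion. Such a $T$ is a vorticity constant of motion if, in addition, it is nontrivial and depends essentially on the vorticity: $T$ is not of the form $K+D_{\mathbf x}\cdot\boldsymbol\Theta$ with $K$ a smooth function of $t,\mathbf x,\mathbf u,\rho,S$ and $\boldsymbol\Theta$ a smooth function of $t,\mathbf x,\mathbf u,\rho,S$ and finitely many $\mathbf x$-derivatives of $\mathbf u,\rho,S$. (i) For any non-isentropic equation of state, in any dimension $n>1$, there are no vorticity constants of motion; in fact every smooth density of vorticity form that is conserved on moving domains is independent of the vorticity. (ii) For any isentropic equation of state: in even dimensions $n=2m$ the vorticity constants of motion are exactly the enstrophies $\int_{V(t)}\rho f(\varpi/\rho)\,d^nx$ with $f$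 a smooth nonlinear (that is, not affine) function, and the smooth densities of vorticity form conserved on moving domains are exactly $T=\rho f(\varpi/\rho)$ with $f$ any smooth function; in odd dimensions there are no vorticity constants of motion, and every smooth density of vorticity form that is conserved on moving domains is independent of the vorticity. -/

import Mathlib

open scoped ContDiff

noncomputable section

namespace CompressibleFlow

/-- Euclidean space `ℝⁿ`. -/
abbrev Space (n : ℕ) := EuclideanSpace ℝ (Fin n)

/-- The `j`-th partial derivative `∂_j F` of a map on `ℝⁿ`. -/
def partialDeriv {n : ℕ} {F : Type*} [NormedAddCommGroup F] [NormedSpace ℝ F]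
    (j : Fin n) (f : Space n → F) (x : Space n) : F :=
  fderiv ℝ f x (EuclideanSpace.single j 1)

/-- The divergence `∑ i, ∂_i X^i` of a vector field on `ℝⁿ`. -/
def divergence {n : ℕ} (X : Space n → Space n) (x : Space n) : ℝ :=
  ∑ i, partialDeriv i X x i

/-! ### Vorticity -/

/-- The curl of the velocity, `ω^{ij} = ½ (∂_j u^i - ∂_i u^j)`. -/
def curl {n : ℕ} (u : Space n → Space n) (x : Space n) (i j : Fin n) : ℝ :=
  (1 / 2) * (partialDeriv j u x i - partialDeriv i u x j)

/-- The vorticity scalar in even dimension `n = 2m`,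
`ϖ = ε^{i₁ j₁ ⋯ i_m j_m} ω_{i₁ j₁} ⋯ ω_{i_m j_m}`; the contraction with the totally
antisymmetric tensor `ε` is written as a sum over permutations of the indices. -/
def vorticityScalar (m : ℕ) (u : Space (2 * m) → Space (2 * m)) (x : Space (2 * m)) : ℝ :=
  ∑ σ : Equiv.Perm (Fin (2 * m)), ((Equiv.Perm.sign σ : ℤ) : ℝ) *
    ∏ k : Fin m, curl u x (σ ⟨2 * k, by omega⟩) (σ ⟨2 * k + 1, by omega⟩)

/-- The vorticity vector in odd dimension `n = 2m + 1`,
`ϖ^i = ε^{i j₁ k₁ ⋯ j_m k_m} ω_{j₁ k₁} ⋯ ω_{j_m k_m}`. -/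
def vorticityVector (m : ℕ) (u : Space (2 * m + 1) → Space (2 * m + 1))
    (x : Space (2 * m + 1)) : Space (2 * m + 1) :=
  WithLp.toLp 2 fun i =>
    ∑ σ : Equiv.Perm (Fin (2 * m + 1)), if σ 0 = i then ((Equiv.Perm.sign σ : ℤ) : ℝ) *
      ∏ k : Fin m, curl u x (σ ⟨2 * k + 1, by omega⟩) (σ ⟨2 * k + 2, by omega⟩) else 0

/-! ### The Euler equations, solved for the time derivatives

A state of the fluid at an instant is a field `x ↦ (u, ρ, S)` (non-isentropic flow, entropy is
a dynamical variable) or `x ↦ (u, ρ)` (isentropic flow, entropy is constant). -/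

/-- `∂_t u = - u·∇u - ρ⁻¹ ∇p`. -/
def velocityRate {n : ℕ} (u : Space n → Space n) (ρ p : Space n → ℝ) (x : Space n) : Space n :=
  -(fderiv ℝ u x (u x)) - (ρ x)⁻¹ • gradient p x

/-- `∂_t ρ = - ∇·(ρ u)`. -/
def densityRate {n : ℕ} (u : Space n → Space n) (ρ : Space n → ℝ) (x : Space n) : ℝ :=
  -divergence (fun y => ρ y • u y) x

/-- `∂_t S = - u·∇S`. -/
def entropyRate {n : ℕ} (u : Space n → Space n) (S : Space n → ℝ) (x : Space n) : ℝ :=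
  -(fderiv ℝ S x (u x))

/-- Time derivative of `(u, ρ, S)` for the equation of state `p = P(ρ, S)`. -/
def eulerRate {n : ℕ} (P : ℝ → ℝ → ℝ) (q : Space n → Space n × ℝ × ℝ) (x : Space n) :
    Space n × ℝ × ℝ :=
  let u := fun y => (q y).1
  let ρ := fun y => (q y).2.1
  let S := fun y => (q y).2.2
  (velocityRate u ρ (fun y => P (ρ y) (S y)) x, densityRate u ρ x, entropyRate u S x)

/-- Time derivative of `(u, ρ)` for the isentropic equation of state `p = P(ρ)`. -/
def isentropicRate {n : ℕ} (P : ℝ → ℝ) (q : Space n → Space n × ℝ) (x : Space n) :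
    Space n × ℝ :=
  let u := fun y => (q y).1
  let ρ := fun y => (q y).2
  (velocityRate u ρ (fun y => P (ρ y)) x, densityRate u ρ x)

/-- Physical values `(u, ρ, S)`: positive density. -/
def physical (n : ℕ) : Set (Space n × ℝ × ℝ) := {s | 0 < s.2.1}

/-- Physical values `(u, ρ)`: positive density. -/
def isentropicPhysical (n : ℕ) : Set (Space n × ℝ) := {s | 0 < s.2}

/-! ### Constants of motion

Below `G` is the space of the thermodynamic variables, `(ρ, S)` or `ρ`; `Ω` is the set of physical
values of the state; `rate` is the time derivative of a state prescribed by the Euler equations;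
`vort u x` is the vorticity of the velocity field `u`, with values in `V`; and `T s w` is a density
of vorticity form, a function of the state `s` and the vorticity `w`. -/

section

variable {n : ℕ} {F G V : Type*} [NormedAddCommGroup F] [NormedSpace ℝ F]
  [NormedAddCommGroup G] [NormedSpace ℝ G] [NormedAddCommGroup V] [NormedSpace ℝ V]

/-- Smooth fields with values in `Ω`. -/
def IsSmoothField (Ω : Set F) (q : Space n → F) : Prop :=
  ContDiff ℝ ∞ q ∧ ∀ x, q x ∈ Ω

/-- The value at `x` of the density `T` on the state `q`. -/
def densityAt (vort : (Space n → Space n) → Space n → V) (T : Space n × G → V → ℝ)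
    (q : Space n → Space n × G) (x : Space n) : ℝ :=
  T (q x) (vort (fun y => (q y).1) x)

/-- The total time derivative `𝒟_t T` evaluated on formal solutions: all time derivatives of the
fields (and, through the vorticity, of their spatial derivatives) are eliminated by means of the
equations of motion. -/
def timeDeriv (rate : (Space n → Space n × G) → Space n → Space n × G)
    (vort : (Space n → Space n) → Space n → V) (T : Space n × G → V → ℝ)
    (q : Space n → Space n × G) (x : Space n) : ℝ :=
  deriv (fun τ : ℝ => densityAt vort T (fun y => q y + τ • rate q y) x) 0

/-- `T` is a smooth density whose integral over every domain moving with the fluid is constant,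
in the local form `𝒟_t T + D_x·(u T) = 0` (zero net flux through the moving boundary), formally for
all solutions of the equations of motion. -/
def IsConservedOnMovingDomains (Ω : Set (Space n × G))
    (rate : (Space n → Space n × G) → Space n → Space n × G)
    (vort : (Space n → Space n) → Space n → V) (T : Space n × G → V → ℝ) : Prop :=
  ContDiffOn ℝ ∞ (fun z : (Space n × G) × V => T z.1 z.2) {z | z.1 ∈ Ω} ∧
  ∀ q, IsSmoothField Ω q → ∀ x,
    timeDeriv rate vort T q x + divergence (fun y => densityAt vort T q y • (q y).1) x = 0

/-- The differential expression `L t q x` is a spatial divergence `D_x·Θ`, where `Θ` is a smooth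
local function of `t`, `x`, the fields, and their `x`-derivatives up to some finite order `k`;
identically in all (not necessarily evolving) fields. -/
def IsSpatialDivergence (Ω : Set F) (L : ℝ → (Space n → F) → Space n → ℝ) : Prop :=
  ∃ (k : ℕ) (Θ : ℝ × Space n × F ×
      ((j : Fin k) → ContinuousMultilinearMap ℝ (fun _ : Fin (j + 1) => Space n) F) → Space n),
    ContDiffOn ℝ ∞ Θ {z | z.2.2.1 ∈ Ω} ∧
    ∀ t q, IsSmoothField Ω q → ∀ x,
      L t q x = divergence
        (fun y => Θ (t, y, q y, fun j : Fin k => iteratedFDeriv ℝ (j + 1) q y)) x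

/-- Up to a trivial density (a spatial divergence), `T` is a kinematic density, a smooth function
`K` of `t`, `x` and the undifferentiated fields. For `K = 0` this says that `T` is trivial. -/
def IsKinematicUpToDivergence (Ω : Set (Space n × G))
    (vort : (Space n → Space n) → Space n → V) (T : Space n × G → V → ℝ) : Prop :=
  ∃ K : ℝ × Space n × (Space n × G) → ℝ,
    ContDiffOn ℝ ∞ K {z | z.2.2 ∈ Ω} ∧
    IsSpatialDivergence Ω fun t q x => densityAt vort T q x - K (t, x, q x)

/-- A vorticity constant of motion: a density conserved on all moving domains that is nontrivial
and depends essentially on the vorticity. -/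
def IsVorticityConstantOfMotion (Ω : Set (Space n × G))
    (rate : (Space n → Space n × G) → Space n → Space n × G)
    (vort : (Space n → Space n) → Space n → V) (T : Space n × G → V → ℝ) : Prop :=
  IsConservedOnMovingDomains Ω rate vort T ∧ ¬ IsKinematicUpToDivergence Ω vort T

/-- On physical states the density does not depend on the vorticity. -/
def IsVorticityIndependent (Ω : Set (Space n × G)) (T : Space n × G → V → ℝ) : Prop :=
  ∀ s ∈ Ω, ∀ w w' : V, T s w = T s w'

end

/-! ### Equations of state -/

/-- A smooth non-isentropic equation of state `p = P(ρ, S)`, `ρ > 0`: there is no open interval of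
entropy values on which the pressure is independent of the entropy. -/
def IsNonIsentropicEOS (P : ℝ → ℝ → ℝ) : Prop :=
  ContDiffOn ℝ ∞ (fun z : ℝ × ℝ => P z.1 z.2) {z | 0 < z.1} ∧
  ∀ a b : ℝ, a < b → ∃ S ∈ Set.Ioo a b, ∃ ρ > 0, deriv (fun s => P ρ s) S ≠ 0

/-- A smooth isentropic equation of state `p = P(ρ)`, `ρ > 0`, not constant. -/
def IsIsentropicEOS (P : ℝ → ℝ) : Prop :=
  ContDiffOn ℝ ∞ P (Set.Ioi 0) ∧ ∃ ρ > 0, deriv P ρ ≠ 0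

/-- `T = ρ f(ϖ/ρ)`, the enstrophy density of the function `f`. -/
def IsEnstrophyDensity {n : ℕ} (f : ℝ → ℝ) (T : Space n × ℝ → ℝ → ℝ) : Prop :=
  ∀ (u : Space n) (ρ ϖ : ℝ), 0 < ρ → T (u, ρ) ϖ = ρ * f (ϖ / ρ)

/-- `f` is an affine function (a linear function up to a constant). -/
def IsAffine (f : ℝ → ℝ) : Prop := ∃ a b : ℝ, ∀ s, f s = a * s + b

end CompressibleFlow

end

open CompressibleFlow

/-!
The velocity gradient, the gradients of `ρ` and `S` and the values of all fields at a point are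
arbitrary, so conservation is an algebraic identity in them. The contraction `F` of `ε` with copies
of a matrix ignores symmetric parts and obeys `F (N w Nᵀ) = det N • F w`, up to the action of `N` on
the free index in odd dimension; differentiating at `N = 1` evaluates the advection term `F'(A) A²`,
and what remains of the pressure term is the baroclinic one, `∇S ⊗ ∇p`.

In odd dimension, take `tr A = 0` and constant density and entropy: the derivative of `T` with
respect to the vorticity `ϖ` vanishes at `A ϖ`, which is arbitrary even when `ϖ ≠ 0` is prescribed.
In even dimension, `tr A` shows that `T` is homogeneous of degree one in `(ρ, ϖ)`. If the pressure
depends on the entropy, the baroclinic term makes `T` independent of `ϖ`; otherwise the pressure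
gradient makes `T` independent of `u`, whence `T = ρ f(ϖ/ρ)`.

Such a density is conserved, and for affine `f` it is `ϖ` plus a function of `ρ` up to a factor,
where `ϖ` is a divergence. Conversely, superimpose a velocity `h` along one axis on a linear shear
flow: if `ρ f(ϖ/ρ)` is kinematic up to a divergence, then `f` of a derivative of `h`, minus a
function of the position and of `h`, integrates to the same value for all `h` that agree outside a
compact set. Its Euler–Lagrange equation makes `f` affine.
-/

namespace CompressibleFlow

open Matrix
open Equiv (Perm sumArrowEquivProdArrow arrowProdEquivProdArrow swap swap_apply_of_ne_of_ne)
open Equiv.Perm (sign sign_swap)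
open scoped Matrix.Norms.Elementwise

/-! ### Contraction of the totally antisymmetric tensor -/

/-- The antisymmetric part of a matrix; for a velocity gradient this is the curl. -/
noncomputable def skewPart {ι : Type*} : Matrix ι ι ℝ →ₗ[ℝ] Matrix ι ι ℝ :=
  (1 / 2 : ℝ) • (LinearMap.id - (transposeLinearEquiv ι ι ℝ ℝ).toLinearMap)

theorem skewPart_apply {ι : Type*} (A : Matrix ι ι ℝ) : skewPart A = (1 / 2 : ℝ) • (A - Aᵀ) :=
  rfl

section PairMatrix

variable {ι κ τ R : Type*} {e : (κ ⊕ κ) ⊕ τ ≃ ι}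

/-- The matrix with entries `1` at the pairs of slots and `0` elsewhere, a reference matrix at which
contractions of `ε` are computed. -/
def pairMatrix (R : Type*) [CommRing R] [DecidableEq ι] [Fintype κ] (e : (κ ⊕ κ) ⊕ τ ≃ ι) :
    Matrix ι ι R :=
  ∑ k, single (e (.inl (.inl k))) (e (.inl (.inr k))) 1

theorem pairMatrix_pair [CommRing R] [DecidableEq ι] [Fintype κ] (k : κ) :
    pairMatrix R e (e (.inl (.inl k))) (e (.inl (.inr k))) = 1 := by
  classical
  simp [pairMatrix, Matrix.sum_apply, single_apply]

theorem exists_pair_of_pairMatrix_ne_zero [CommRing R] [DecidableEq ι] [Fintype κ] {i j : ι}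
    (h : pairMatrix R e i j ≠ 0) :
    ∃ k, e (.inl (.inl k)) = i ∧ e (.inl (.inr k)) = j := by
  rw [pairMatrix, Matrix.sum_apply] at h
  obtain ⟨k, -, hk⟩ := Finset.exists_ne_zero_of_sum_ne_zero h
  exact ⟨k, by_contra fun hne => hk (single_apply_of_ne _ _ _ _ _ hne)⟩

/-- The permutation of the slots that permutes the pairs by `p.1` and the single slots by `p.2`.
Only these contribute to a contraction of `ε` with copies of `pairMatrix`. -/
def slotPerm (e : (κ ⊕ κ) ⊕ τ ≃ ι) (p : Perm κ × Perm τ) : Perm ι :=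
  e.permCongr ((p.1.sumCongr p.1).sumCongr p.2)

theorem slotPerm_injective : Function.Injective (slotPerm e) := by
  intro p q h
  ext x
  · simpa [slotPerm] using congr($h (e (.inl (.inl x))))
  · simpa [slotPerm] using congr($h (e (.inr x)))

theorem mem_range_slotPerm [Finite κ] [Finite τ] {σ : Perm ι}
    (h : ∀ k, ∃ k', e (.inl (.inl k')) = σ (e (.inl (.inl k))) ∧
    e (.inl (.inr k')) = σ (e (.inl (.inr k)))) : σ ∈ Set.range (slotPerm e) := by
  choose f hl hr using h
  obtain ⟨⟨ρ, q⟩, hρ⟩ : e.symm.permCongr σ ∈ (Equiv.Perm.sumCongrHom (κ ⊕ κ) τ).range := by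
    refine Equiv.Perm.mem_sumCongrHom_range_of_perm_mapsTo_inl ?_
    rintro _ ⟨k | k, rfl⟩
    · exact ⟨.inl (f k), by simp [← hl]⟩
    · exact ⟨.inr (f k), by simp [← hr]⟩
  have hρl : ∀ k, ρ (.inl k) = .inl (f k) := fun k => by
    simpa [← hl] using congr($hρ (.inl (.inl k)))
  have hρr : ∀ k, ρ (.inr k) = .inr (f k) := fun k => by
    simpa [← hr] using congr($hρ (.inl (.inr k)))
  have hf : Function.Injective f := fun a b hab => by
    simpa using ρ.injective ((hρl a).trans (congrArg _ hab |>.trans (hρl b).symm))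
  refine ⟨⟨.ofBijective f (Finite.injective_iff_bijective.1 hf), q⟩, ?_⟩
  rw [slotPerm, ← Equiv.eq_symm_apply, Equiv.permCongr_symm, ← hρ]
  ext x
  obtain (k | k) | t := x <;> simp [hρl, hρr]

end PairMatrix

section EpsilonContraction

variable {ι κ τ R : Type*} [Fintype ι] [DecidableEq ι] [CommRing R]

theorem sum_mul_det_submatrix (A : Matrix ι ι R) (c : (ι → ι) → R) :
    ∑ φ : ι → ι, c φ * (A.submatrix id φ).det = A.det * ∑ σ : Perm ι, (sign σ : ℤ) * c σ := by
  have of_not_injective : ∀ φ : ι → ι, φ ∉ Set.range ((⇑) : Perm ι → ι → ι) →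
      c φ * (A.submatrix id φ).det = 0 := fun φ hφ => by
    have hφ : ¬ Function.Injective φ := fun h =>
      hφ ⟨.ofBijective φ (Finite.injective_iff_bijective.1 h), rfl⟩
    obtain ⟨i, j, hij, hne⟩ := Function.not_injective_iff.1 hφ
    rw [det_zero_of_column_eq hne fun k => by simp [hij], mul_zero]
  rw [← Fintype.sum_of_injective _ DFunLike.coe_injective _ _ of_not_injective fun _ => rfl,
    Finset.mul_sum]
  refine Fintype.sum_congr _ _ fun σ => ?_
  rw [det_permute']
  ring

variable [Fintype κ] [Fintype τ]

/-- The contraction of the totally antisymmetric tensor `ε`, whose slots are split by `e` into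
pairs and single slots, with a vector `v t` in each single slot `t` and a matrix in each pair. -/
noncomputable def epsilonContraction (e : (κ ⊕ κ) ⊕ τ ≃ ι) (v : τ → ι → R) :
    MultilinearMap R (fun _ : κ => Matrix ι ι R) R :=
  ∑ σ : Perm ι, (((sign σ : ℤ) : R) * ∏ t, v t (σ (e (.inr t)))) •
    (MultilinearMap.mkPiAlgebra R κ R).compLinearMap fun k =>
      entryLinearMap R R (σ (e (.inl (.inl k)))) (σ (e (.inl (.inr k))))

variable {e : (κ ⊕ κ) ⊕ τ ≃ ι}

theorem epsilonContraction_apply (v : τ → ι → R) (M : κ → Matrix ι ι R) :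
    epsilonContraction e v M = ∑ σ : Perm ι, ((sign σ : ℤ) : R) *
      ((∏ t, v t (σ (e (.inr t)))) *
        ∏ k, M k (σ (e (.inl (.inl k)))) (σ (e (.inl (.inr k))))) := by
  simp [epsilonContraction, mul_assoc]

theorem prod_mulVec_mul_prod_conj (v : τ → ι → R) (M : κ → Matrix ι ι R) (A : Matrix ι ι R)
    (σ : ι → ι) :
    (∏ t, (A *ᵥ v t) (σ (e (.inr t)))) *
        ∏ k, (A * M k * Aᵀ) (σ (e (.inl (.inl k)))) (σ (e (.inl (.inr k)))) =
      ∑ φ : ι → ι, (∏ i, A (σ i) (φ i)) * ((∏ t, v t (φ (e (.inr t)))) *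
        ∏ k, M k (φ (e (.inl (.inl k)))) (φ (e (.inl (.inr k))))) := by
  classical
  have conj_apply : ∀ (N : Matrix ι ι R) i j,
      (A * N * Aᵀ) i j = ∑ p : ι × ι, A i p.1 * A j p.2 * N p.1 p.2 := fun N i j => by
    rw [Fintype.sum_prod_type_right]
    simp only [mul_apply, transpose_apply, Finset.sum_mul]
    exact Fintype.sum_congr _ _ fun b => Fintype.sum_congr _ _ fun a => by ring
  simp only [conj_apply, mulVec, dotProduct, Fintype.prod_sum, Fintype.sum_mul_sum,
    ← Fintype.sum_prod_type']
  refine Fintype.sum_equiv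
    (((Equiv.prodComm _ _).trans (((arrowProdEquivProdArrow _ _ _).trans
      (sumArrowEquivProdArrow _ _ _).symm).prodCongr (.refl _))).trans
      ((sumArrowEquivProdArrow _ _ _).symm.trans (e.arrowCongr (.refl _)))) _ _ fun p => ?_
  rw [← e.prod_comp]
  simp [Fintype.prod_sum_type, Finset.prod_mul_distrib, sumArrowEquivProdArrow,
    arrowProdEquivProdArrow]
  ring

theorem epsilonContraction_conj (v : τ → ι → R) (M : κ → Matrix ι ι R) (A : Matrix ι ι R) :
    epsilonContraction e (fun t => A *ᵥ v t) (fun k => A * M k * Aᵀ) =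
      A.det * epsilonContraction e v M := by
  rw [epsilonContraction_apply, epsilonContraction_apply, ← sum_mul_det_submatrix A fun φ =>
    (∏ t, v t (φ (e (.inr t)))) * ∏ k, M k (φ (e (.inl (.inl k)))) (φ (e (.inl (.inr k))))]
  simp only [prod_mulVec_mul_prod_conj, Finset.mul_sum, det_apply', submatrix_apply, id]
  rw [Finset.sum_comm]
  exact Fintype.sum_congr _ _ fun φ => Fintype.sum_congr _ _ fun σ => by ring

theorem epsilonContraction_eq_zero_of_isSymm (v : τ → ι → R) {M : κ → Matrix ι ι R} {k : κ}
    (hM : (M k).IsSymm) : epsilonContraction e v M = 0 := by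
  classical
  rw [epsilonContraction_apply]
  set s := swap (e (.inl (.inl k))) (e (.inl (.inr k)))
  have hs : e (.inl (.inl k)) ≠ e (.inl (.inr k)) := by simp
  refine Finset.sum_involution (fun σ _ => σ * s) (fun σ _ => ?_) (fun σ _ _ => ?_) (by simp)
    fun σ _ => by simp [s, mul_assoc]
  · have hsingle : ∀ t, s (e (.inr t)) = e (.inr t) := fun t =>
      swap_apply_of_ne_of_ne (by simp) (by simp)
    have hpair : ∀ j, M j (σ (s (e (.inl (.inl j))))) (σ (s (e (.inl (.inr j))))) =
        M j (σ (e (.inl (.inl j)))) (σ (e (.inl (.inr j)))) := fun j => by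
      obtain rfl | hj := eq_or_ne j k
      · simp [s, hM.apply]
      · simp [s, swap_apply_of_ne_of_ne, hj]
    have hsign : sign (σ * s) = -sign σ := by simp [s, sign_swap hs]
    simp only [hsign, Perm.mul_apply, hsingle, hpair]
    simp
  · simp [s]

theorem epsilonContraction_skewPart (v : τ → ι → ℝ) (M : κ → Matrix ι ι ℝ) :
    epsilonContraction e v (fun k => skewPart (M k)) = epsilonContraction e v M := by
  classical
  have decomp : M = (fun k => skewPart (M k)) + fun k => (1 / 2 : ℝ) • (M k + (M k)ᵀ) := by
    funext k
    rw [Pi.add_apply, skewPart_apply]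
    module
  conv_rhs => rw [decomp, MultilinearMap.map_add_univ]
  rw [Fintype.sum_eq_single Finset.univ, Finset.piecewise_univ]
  intro s hs
  obtain ⟨k, hk⟩ : ∃ k, k ∉ s := by simpa [Finset.eq_univ_iff_forall] using hs
  refine epsilonContraction_eq_zero_of_isSymm v (k := k) ?_
  rw [Finset.piecewise_eq_of_notMem _ _ _ hk]
  exact (isSymm_add_transpose_self _).smul _

theorem epsilonContraction_pairMatrix [DecidableEq τ] (v : τ → ι → R) :
    epsilonContraction e v (fun _ => pairMatrix R e) =
      (Fintype.card κ).factorial * (of fun t t' => v t (e (.inr t'))).det := by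
  classical
  have of_notMem : ∀ σ ∉ Set.range (slotPerm e), ((sign σ : ℤ) : R) *
      ((∏ t, v t (σ (e (.inr t)))) *
        ∏ k, pairMatrix R e (σ (e (.inl (.inl k)))) (σ (e (.inl (.inr k))))) = 0 := by
    intro σ hσ
    obtain ⟨k, hk⟩ : ∃ k, pairMatrix R e (σ (e (.inl (.inl k)))) (σ (e (.inl (.inr k)))) = 0 := by
      by_contra! h
      exact hσ (mem_range_slotPerm fun k => exists_pair_of_pairMatrix_ne_zero (h k))
    rw [Finset.prod_eq_zero (Finset.mem_univ k) hk, mul_zero, mul_zero]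
  rw [epsilonContraction_apply, ← Fintype.sum_of_injective _ slotPerm_injective
    (fun p => ((sign p.2 : ℤ) : R) * ∏ t, v t (e (.inr (p.2 t)))) _ of_notMem fun p => ?_]
  · rw [Fintype.sum_prod_type, ← det_transpose]
    simp [det_apply', Fintype.card_perm]
  · simp [slotPerm, pairMatrix_pair]

theorem epsilonContraction_update_update_vecMulVec [DecidableEq κ] (v : τ → ι → R)
    (M : κ → Matrix ι ι R) {k l : κ} (hkl : k ≠ l) (a b x y : ι → R) :
    epsilonContraction e v
        (Function.update (Function.update M k (vecMulVec a x)) l (vecMulVec b y)) =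
      -epsilonContraction e v
        (Function.update (Function.update M k (vecMulVec a y)) l (vecMulVec b x)) := by
  have expand (x y : ι → R) (f g : κ → ι) :
      ∏ j, Function.update (Function.update M k (vecMulVec a x)) l (vecMulVec b y) j (f j) (g j) =
        a (f k) * x (g k) * (b (f l) * y (g l) *
          ∏ j ∈ (Finset.univ.erase k).erase l, M j (f j) (g j)) := by
    rw [← Finset.mul_prod_erase _ _ (Finset.mem_univ k), ← Finset.mul_prod_erase _ _
      (Finset.mem_erase.2 ⟨hkl.symm, Finset.mem_univ l⟩), Finset.prod_congr rfl (g := fun j =>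
        M j (f j) (g j)) fun j hj => by rw [Function.update_of_ne (Finset.ne_of_mem_erase hj),
          Function.update_of_ne (Finset.ne_of_mem_erase (Finset.mem_of_mem_erase hj))]]
    simp [hkl, vecMulVec_apply]
  rw [epsilonContraction_apply, epsilonContraction_apply, ← Finset.sum_neg_distrib]
  set s := swap (e (.inl (.inr k))) (e (.inl (.inr l)))
  refine Fintype.sum_equiv (Equiv.mulRight s) _ _ fun σ => ?_
  have hsign : sign (σ * s) = -sign σ := by simp [s, hkl]
  have hsingle : ∀ t, s (e (.inr t)) = e (.inr t) := fun t =>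
    swap_apply_of_ne_of_ne (by simp) (by simp)
  have hleft : ∀ j, s (e (.inl (.inl j))) = e (.inl (.inl j)) := fun j =>
    swap_apply_of_ne_of_ne (by simp) (by simp)
  have hrest : ∏ j ∈ (Finset.univ.erase k).erase l,
      M j (σ (e (.inl (.inl j)))) (σ (s (e (.inl (.inr j))))) =
        ∏ j ∈ (Finset.univ.erase k).erase l,
          M j (σ (e (.inl (.inl j)))) (σ (e (.inl (.inr j)))) := by
    refine Finset.prod_congr rfl fun j hj => ?_
    have hjk := Finset.ne_of_mem_erase (Finset.mem_of_mem_erase hj)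
    have hjl := Finset.ne_of_mem_erase hj
    rw [swap_apply_of_ne_of_ne (by simpa) (by simpa)]
  simp only [Equiv.coe_mulRight, hsign, Perm.mul_apply, hsingle, hleft, expand, hrest,
    s, Equiv.swap_apply_left, Equiv.swap_apply_right]
  push_cast
  ring

end EpsilonContraction

/-! ### Vorticity as a function of the velocity gradient -/

section VorticityForm

/-- The slots of `ε` in even dimension: the pairs are `(2k, 2k + 1)`. -/
noncomputable def evenSlots (m : ℕ) : (Fin m ⊕ Fin m) ⊕ Fin 0 ≃ Fin (2 * m) :=
  .ofBijective (Sum.elim (Sum.elim (fun k => ⟨2 * k, by omega⟩) fun k =>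
    ⟨2 * k + 1, by omega⟩)
    Fin.elim0) <| by
  rw [Fintype.bijective_iff_injective_and_card]
  constructor
  · rintro ((a | a) | ⟨_, ⟨⟩⟩) ((b | b) | ⟨_, ⟨⟩⟩) h <;> simp [Fin.ext_iff] at h ⊢ <;> omega
  · simp [two_mul]

/-- The slots of `ε` in odd dimension: the single slot is `0`, the pairs are `(2k + 1, 2k + 2)`. -/
noncomputable def oddSlots (m : ℕ) : (Fin m ⊕ Fin m) ⊕ Fin 1 ≃ Fin (2 * m + 1) :=
  .ofBijective (Sum.elim (Sum.elim (fun k => ⟨2 * k + 1, by omega⟩) fun k =>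
    ⟨2 * k + 2, by omega⟩)
    fun _ => ⟨0, by omega⟩) <| by
  rw [Fintype.bijective_iff_injective_and_card]
  constructor
  · rintro ((a | a) | a) ((b | b) | b) h <;> simp [Fin.ext_iff] at h ⊢ <;> omega
  · simp [two_mul]

variable {m : ℕ}

/-- The vorticity scalar as a function of the curl or, equivalently, of the velocity gradient. -/
noncomputable def scalarForm (w : Matrix (Fin (2 * m)) (Fin (2 * m)) ℝ) : ℝ :=
  epsilonContraction (evenSlots m) ![] fun _ => w

/-- The vorticity vector as a function of the curl or, equivalently, of the velocity gradient. -/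
noncomputable def vectorForm (w : Matrix (Fin (2 * m + 1)) (Fin (2 * m + 1)) ℝ) :
    Space (2 * m + 1) :=
  WithLp.toLp 2 fun i => epsilonContraction (oddSlots m) ![Pi.single i 1] fun _ => w

theorem vorticityScalar_eq_scalarForm_curl (u : Space (2 * m) → Space (2 * m))
    (x : Space (2 * m)) :
    vorticityScalar m u x = scalarForm (of (curl u x)) := by
  rw [scalarForm, epsilonContraction_apply]
  simp only [Finset.univ_eq_empty, Finset.prod_empty, one_mul]
  rfl

theorem vorticityVector_eq_vectorForm_curl (u : Space (2 * m + 1) → Space (2 * m + 1))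
    (x : Space (2 * m + 1)) : vorticityVector m u x = vectorForm (of (curl u x)) := by
  ext i
  simp only [vectorForm, epsilonContraction_apply, Fin.prod_univ_one, cons_val_zero,
    Pi.single_apply, ite_mul, one_mul, zero_mul, mul_ite, mul_zero]
  rfl

theorem contDiff_epsilonContraction {ι κ τ : Type*} [Fintype ι] [DecidableEq ι] [Fintype κ]
    [Fintype τ] (e : (κ ⊕ κ) ⊕ τ ≃ ι) (v : τ → ι → ℝ) : ContDiff ℝ ∞ (epsilonContraction e v) := by
  simp only [funext (epsilonContraction_apply v)]
  refine ContDiff.sum fun σ _ =>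
    contDiff_const.mul (contDiff_const.mul (contDiff_prod fun k _ => ?_))
  exact (contDiff_apply_apply ℝ ℝ _ _).comp (contDiff_apply ℝ (Matrix ι ι ℝ) k)

theorem contDiff_scalarForm : ContDiff ℝ ∞ (scalarForm (m := m)) :=
  (contDiff_epsilonContraction _ _).comp (contDiff_pi.2 fun _ => contDiff_id)

theorem contDiff_vectorForm : ContDiff ℝ ∞ (vectorForm (m := m)) :=
  contDiff_euclidean.2 fun _ =>
    (contDiff_epsilonContraction _ _).comp (contDiff_pi.2 fun _ => contDiff_id)

theorem scalarForm_skewPart (A : Matrix (Fin (2 * m)) (Fin (2 * m)) ℝ) :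
    scalarForm (skewPart A) = scalarForm A :=
  epsilonContraction_skewPart _ fun _ => A

theorem vectorForm_skewPart (A : Matrix (Fin (2 * m + 1)) (Fin (2 * m + 1)) ℝ) :
    vectorForm (skewPart A) = vectorForm A :=
  congrArg (WithLp.toLp 2) <| funext fun _ => epsilonContraction_skewPart _ fun _ => A

theorem scalarForm_conj (w A : Matrix (Fin (2 * m)) (Fin (2 * m)) ℝ) :
    scalarForm (A * w * Aᵀ) = A.det * scalarForm w := by
  rw [scalarForm, scalarForm, ← epsilonContraction_conj]
  congr 2
  exact Subsingleton.elim _ _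

theorem vectorForm_dotProduct (w : Matrix (Fin (2 * m + 1)) (Fin (2 * m + 1)) ℝ)
    (v : Fin (2 * m + 1) → ℝ) :
    (vectorForm w).ofLp ⬝ᵥ v = epsilonContraction (oddSlots m) ![v] fun _ => w := by
  simp only [vectorForm, dotProduct, epsilonContraction_apply, Fin.prod_univ_one, cons_val_zero,
    Finset.sum_mul]
  rw [Finset.sum_comm]
  refine Fintype.sum_congr _ _ fun σ => ?_
  rw [Fintype.sum_eq_single (σ (oddSlots m (.inr 0))) fun i hi => by simp [hi.symm]]
  simp only [Pi.single_eq_same, one_mul]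
  ring

theorem vecMul_vectorForm_conj (w A : Matrix (Fin (2 * m + 1)) (Fin (2 * m + 1)) ℝ) :
    (vectorForm (A * w * Aᵀ)).ofLp ᵥ* A = A.det • (vectorForm w).ofLp := by
  refine dotProduct_eq _ _ fun v => ?_
  rw [← dotProduct_mulVec, vectorForm_dotProduct, smul_dotProduct, vectorForm_dotProduct,
    smul_eq_mul, ← epsilonContraction_conj]
  congr 2
  simp [funext_iff]

theorem vectorForm_pairMatrix :
    vectorForm (pairMatrix ℝ (oddSlots m)) = EuclideanSpace.single 0 (m.factorial : ℝ) := by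
  ext i
  simp [vectorForm, epsilonContraction_pairMatrix, Pi.single_apply, oddSlots, eq_comm]

theorem scalarForm_pairMatrix_add (k : Fin m) (a : Fin (2 * m) → ℝ) :
    scalarForm (pairMatrix ℝ (evenSlots m) +
        vecMulVec (Pi.single (evenSlots m (.inl (.inl k))) 1) a) =
      (1 + a (evenSlots m (.inl (.inr k)))) * m.factorial := by
  set i := evenSlots m (.inl (.inl k))
  set j := evenSlots m (.inl (.inr k))
  set J := pairMatrix ℝ (evenSlots m)
  have col_j : J *ᵥ Pi.single j 1 = Pi.single i 1 := by
    ext l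
    simp only [J, pairMatrix, mulVec_single_one, col_apply, Matrix.sum_apply]
    rw [Fintype.sum_eq_single k fun l hl => by simp [j, hl]]
    simp [i, j, Pi.single_apply, single_apply, eq_comm]
  have row_j : Pi.single j 1 ᵥ* J = 0 := by
    ext l
    simp [J, pairMatrix, j, Matrix.sum_apply]
  have conj : (1 + vecMulVec a (Pi.single j 1)) * J * (1 + vecMulVec a (Pi.single j 1))ᵀ =
      J + vecMulVec (Pi.single i 1) a := by
    simp [Matrix.add_mul, Matrix.mul_add, vecMulVec_mul, mul_vecMulVec, row_j, col_j]
  rw [← conj, scalarForm_conj, vecMulVec_eq Unit, det_one_add_replicateCol_mul_replicateRow]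
  simp [scalarForm, J, epsilonContraction_pairMatrix]

end VorticityForm

theorem apply_add_of_isSymm {ι E : Type*} {F : Matrix ι ι ℝ → E} (hF : ∀ A, F (skewPart A) = F A)
    (A : Matrix ι ι ℝ) {S : Matrix ι ι ℝ} (hS : S.IsSymm) : F (A + S) = F A := by
  rw [← hF, map_add, skewPart_apply S, hS.eq, sub_self, smul_zero, add_zero, hF]

theorem fderiv_eq_zero_of_isSymm {ι E : Type*} [Finite ι] [NormedAddCommGroup E]
    [NormedSpace ℝ E] {F : Matrix ι ι ℝ → E} (hF : ∀ A, F (skewPart A) = F A)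
    {A S : Matrix ι ι ℝ} (hFA : DifferentiableAt ℝ F A) (hS : S.IsSymm) : fderiv ℝ F A S = 0 := by
  cases nonempty_fintype ι
  have const (t : ℝ) : F (A + t • S) = F A := apply_add_of_isSymm hF A (hS.smul t)
  exact hFA.lineDeriv_eq_fderiv.symm.trans (by rw [lineDeriv, funext const, deriv_const])

section LinearFlow

variable {ι : Type*} [Fintype ι] [DecidableEq ι]

theorem hasDerivAt_conj_one_add_smul (A w : Matrix ι ι ℝ) :
    HasDerivAt (fun t : ℝ => (1 + t • A)ᵀ * w * (1 + t • A)) (Aᵀ * w + w * A) 0 := by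
  have expand : (fun t : ℝ => (1 + t • A)ᵀ * w * (1 + t • A)) =
      fun t : ℝ => w + t • (Aᵀ * w + w * A) + t ^ 2 • (Aᵀ * w * A) := by
    funext t
    simp only [transpose_add, transpose_one, transpose_smul, Matrix.add_mul,
      Matrix.mul_add, Matrix.one_mul, Matrix.mul_one, smul_mul, mul_smul_comm]
    module
  have h : HasDerivAt (fun t : ℝ => w + t • (Aᵀ * w + w * A) + t ^ 2 • (Aᵀ * w * A))
      ((1 : ℝ) • (Aᵀ * w + w * A) + (2 * (0 : ℝ) ^ 1 * 1) • (Aᵀ * w * A)) 0 :=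
    (((hasDerivAt_id (0 : ℝ)).smul_const _).const_add _).add
      (((hasDerivAt_id (0 : ℝ)).pow 2).smul_const _)
  rw [expand]
  convert h using 1
  simp

theorem hasDerivAt_comp_conj_one_add_smul {E : Type*} [NormedAddCommGroup E] [NormedSpace ℝ E]
    {F : Matrix ι ι ℝ → E} {w : Matrix ι ι ℝ} (hF : DifferentiableAt ℝ F w) (A : Matrix ι ι ℝ) :
    HasDerivAt (fun t : ℝ => F ((1 + t • A)ᵀ * w * (1 + t • A)))
      (fderiv ℝ F w (Aᵀ * w + w * A)) 0 :=
  hF.hasFDerivAt.comp_hasDerivAt_of_eq 0 (hasDerivAt_conj_one_add_smul A w) (by simp)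

theorem hasDerivAt_det_one_add_smul (A : Matrix ι ι ℝ) :
    HasDerivAt (fun t : ℝ => (1 + t • A).det) A.trace 0 := by
  rw [funext fun t : ℝ => det_one_add_smul t A]
  set p := (det (1 + (Polynomial.X : Polynomial ℝ) • A.map Polynomial.C)).divX.divX
  have h := (((hasDerivAt_id (0 : ℝ)).const_mul A.trace).const_add 1).add
    ((p.hasDerivAt 0).mul ((hasDerivAt_id (0 : ℝ)).pow 2))
  simpa [Pi.add_def, Pi.mul_def] using h

end LinearFlow

section VorticityFormDerivative

variable {m : ℕ}

theorem fderiv_scalarForm_transpose_mul_add_mul (A w : Matrix (Fin (2 * m)) (Fin (2 * m)) ℝ) :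
    fderiv ℝ scalarForm w (Aᵀ * w + w * A) = A.trace * scalarForm w := by
  refine (hasDerivAt_comp_conj_one_add_smul (contDiff_scalarForm.differentiable (by simp) w)
    A).unique ?_
  refine ((hasDerivAt_det_one_add_smul A).mul_const (scalarForm w)).congr_of_eventuallyEq <|
    .of_eq <| funext fun t => ?_
  rw [← det_transpose, ← scalarForm_conj, transpose_transpose]

theorem fderiv_vectorForm_transpose_mul_add_mul
    (A w : Matrix (Fin (2 * m + 1)) (Fin (2 * m + 1)) ℝ) :
    fderiv ℝ vectorForm w (Aᵀ * w + w * A) =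
      A.trace • vectorForm w - toEuclideanCLM (𝕜 := ℝ) A (vectorForm w) := by
  have hv := hasDerivAt_comp_conj_one_add_smul
    (contDiff_vectorForm.differentiable (by simp) w) A
  have hAv := hv.add ((hasDerivAt_id (0 : ℝ)).smul
    ((toEuclideanCLM (n := Fin (2 * m + 1)) (𝕜 := ℝ) A).hasFDerivAt.comp_hasDerivAt 0 hv))
  have conj : ∀ t : ℝ, vectorForm ((1 + t • A)ᵀ * w * (1 + t • A)) + t • toEuclideanCLM (𝕜 := ℝ) A
      (vectorForm ((1 + t • A)ᵀ * w * (1 + t • A))) = (1 + t • A).det • vectorForm w := fun t => by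
    have h := vecMul_vectorForm_conj w (1 + t • A)ᵀ
    rw [vecMul_transpose, transpose_transpose, det_transpose, add_mulVec, one_mulVec,
      smul_mulVec] at h
    ext i
    simpa using congrFun h i
  have h := hAv.unique (((hasDerivAt_det_one_add_smul A).smul_const
    (vectorForm w)).congr_of_eventuallyEq <| .of_eq <| funext conj)
  simpa [eq_sub_iff_add_eq] using h

theorem fderiv_scalarForm_mul_self (A : Matrix (Fin (2 * m)) (Fin (2 * m)) ℝ) :
    fderiv ℝ scalarForm A (A * A) = A.trace * scalarForm A := by
  rw [← fderiv_scalarForm_transpose_mul_add_mul, map_add, fderiv_eq_zero_of_isSymm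
    scalarForm_skewPart (contDiff_scalarForm.differentiable (by simp) A)
    (isSymm_transpose_mul_self A), zero_add]

theorem fderiv_vectorForm_mul_self (A : Matrix (Fin (2 * m + 1)) (Fin (2 * m + 1)) ℝ) :
    fderiv ℝ vectorForm A (A * A) =
      A.trace • vectorForm A - toEuclideanCLM (𝕜 := ℝ) A (vectorForm A) := by
  rw [← fderiv_vectorForm_transpose_mul_add_mul, map_add, fderiv_eq_zero_of_isSymm
    vectorForm_skewPart (contDiff_vectorForm.differentiable (by simp) A)
    (isSymm_transpose_mul_self A), zero_add]

end VorticityFormDerivative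

section Prescription

variable {m : ℕ}

theorem exists_vectorForm_eq (hm : 1 ≤ m) {v : Space (2 * m + 1)} (hv : v 0 ≠ 0) :
    ∃ A, vectorForm A = v := by
  have hm' : (m.factorial : ℝ) ≠ 0 := by positivity
  have : Nontrivial (Fin (2 * m + 1)) := Fin.nontrivial_iff_two_le.2 (by omega)
  obtain ⟨i, hi⟩ := exists_ne (0 : Fin (2 * m + 1))
  set N : Matrix (Fin (2 * m + 1)) (Fin (2 * m + 1)) ℝ :=
    diagonal (Pi.mulSingle i (m.factorial / v 0)) * updateRow 1 0 v.ofLp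
  have row_zero : Pi.single 0 1 ᵥ* N = v.ofLp := by
    ext j
    simp [N, ← vecMul_vecMul, hi.symm]
  have det_N : N.det = m.factorial := by
    rw [det_mul, det_diagonal, Fintype.prod_pi_mulSingle', ← cramer_transpose_apply,
      transpose_one, cramer_one]
    simp [hv]
  have unit_N : IsUnit N.det := by simpa [det_N] using hm'
  refine ⟨N⁻¹ * pairMatrix ℝ (oddSlots m) * N⁻¹ᵀ, ?_⟩
  have h := congrArg (· ᵥ* N) (vecMul_vectorForm_conj (pairMatrix ℝ (oddSlots m)) N⁻¹)
  simp only [vecMul_vecMul, nonsing_inv_mul N unit_N, vecMul_one, det_nonsing_inv, det_N,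
    vectorForm_pairMatrix, Ring.inverse_eq_inv', PiLp.ofLp_single] at h
  rw [← Pi.single_smul, smul_eq_mul, inv_mul_cancel₀ hm', row_zero] at h
  exact WithLp.ofLp_injective 2 h

theorem exists_isSymm_mulVec_eq {ι : Type*} [Fintype ι] [Nontrivial ι]
    {v : ι → ℝ} (hv : v ≠ 0) (y : ι → ℝ) (τ : ℝ) :
    ∃ E : Matrix ι ι ℝ, E.IsSymm ∧ E.trace = τ ∧ E *ᵥ v = y := by
  classical
  have hN : v ⬝ᵥ v ≠ 0 := dotProduct_self_eq_zero.not.2 hv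
  have hn : (Fintype.card ι : ℝ) - 1 ≠ 0 :=
    sub_ne_zero.2 (mod_cast Fintype.one_lt_card.ne')
  set N := v ⬝ᵥ v
  set s := y ⬝ᵥ v
  -- the first two terms map `v` to `y`; the projection onto `vᗮ` then adjusts the trace
  refine ⟨N⁻¹ • (vecMulVec y v + vecMulVec v y) - (s / N ^ 2) • vecMulVec v v +
    ((τ - s / N) / (Fintype.card ι - 1)) • (1 - N⁻¹ • vecMulVec v v), ?_, ?_, ?_⟩
  · ext i j
    simp only [smul_add, transpose_apply, Matrix.add_apply, Matrix.sub_apply, Matrix.smul_apply,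
      vecMulVec_apply, smul_eq_mul, one_apply, eq_comm]
    ring
  · simp only [trace_add, trace_sub, trace_smul, trace_vecMulVec, trace_one, smul_eq_mul,
      dotProduct_comm v y]
    change _ * (s + s) - _ * N + _ * (_ - _ * N) = τ
    field_simp
    ring
  · simp only [add_mulVec, sub_mulVec, smul_mulVec, vecMulVec_mulVec, one_mulVec]
    change N⁻¹ • (MulOpposite.op N • y + MulOpposite.op s • v) - _ • MulOpposite.op N • v +
      _ • (v - N⁻¹ • MulOpposite.op N • v) = y
    simp only [op_smul_eq_smul, smul_add, smul_smul, inv_mul_cancel₀ hN, one_smul, sub_self,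
      smul_zero, add_zero]
    rw [show s / N ^ 2 * N = N⁻¹ * s by field_simp, add_sub_cancel_right]

theorem exists_vectorForm_eq_apply_eq (hm : 1 ≤ m) {v : Space (2 * m + 1)} (hv : v 0 ≠ 0)
    (y : Space (2 * m + 1)) :
    ∃ A, A.trace = 0 ∧ vectorForm A = v ∧ toEuclideanCLM (𝕜 := ℝ) A v = y := by
  obtain ⟨A, hA⟩ := exists_vectorForm_eq hm hv
  have : Nontrivial (Fin (2 * m + 1)) := Fin.nontrivial_iff_two_le.2 (by omega)
  obtain ⟨E, symm_E, trace_E, hE⟩ := exists_isSymm_mulVec_eq (v := v.ofLp)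
    (fun h => hv (congrFun h 0)) (y.ofLp - A *ᵥ v.ofLp) (-A.trace)
  refine ⟨A + E, by rw [trace_add, trace_E, add_neg_cancel], ?_, ?_⟩
  · rw [apply_add_of_isSymm vectorForm_skewPart A symm_E, hA]
  · refine WithLp.ofLp_injective 2 ?_
    rw [ofLp_toEuclideanCLM, add_mulVec, hE, add_sub_cancel]

theorem dense_apply_ne_zero {n : ℕ} (i : Fin n) : Dense {v : Space n | v i ≠ 0} :=
  (dense_compl_singleton (0 : ℝ)).preimage
    ((EuclideanSpace.proj i : Space n →L[ℝ] ℝ).isOpenMap fun s =>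
      ⟨EuclideanSpace.single i s, by simp⟩)

theorem exists_scalarForm_eq (hm : 1 ≤ m) (τ s : ℝ) :
    ∃ A : Matrix (Fin (2 * m)) (Fin (2 * m)) ℝ, A.trace = τ ∧ scalarForm A = s ∧
      ∃ a b, fderiv ℝ scalarForm A (vecMulVec a b) ≠ 0 := by
  have hm' : (m.factorial : ℝ) ≠ 0 := by positivity
  set i := evenSlots m (.inl (.inl ⟨0, hm⟩))
  set j := evenSlots m (.inl (.inr ⟨0, hm⟩))
  have hij : i ≠ j := by simp [i, j]
  set J := pairMatrix ℝ (evenSlots m)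
  have trace_J : J.trace = 0 := by simp [J, pairMatrix, trace_sum]
  set a : Fin (2 * m) → ℝ := Pi.single i τ + Pi.single j (s / m.factorial - 1)
  have line : ∀ t : ℝ, scalarForm (J + vecMulVec (Pi.single i 1) a +
      t • vecMulVec (Pi.single i 1) (Pi.single j 1)) = s + t * m.factorial := fun t => by
    rw [← vecMulVec_smul, add_assoc, ← vecMulVec_add, scalarForm_pairMatrix_add]
    simp only [Pi.add_apply, ne_eq, EmbeddingLike.apply_eq_iff_eq, Sum.inl.injEq, reduceCtorEq,
      not_false_eq_true, Pi.single_eq_of_ne, Pi.single_eq_same, zero_add, Pi.smul_apply,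
      smul_eq_mul, mul_one, a, i, j]
    field_simp
    ring
  have diff : DifferentiableAt ℝ scalarForm (J + vecMulVec (Pi.single i 1) a) :=
    contDiff_scalarForm.differentiable (by simp) _
  refine ⟨J + vecMulVec (Pi.single i 1) a, ?_, by simpa using line 0, Pi.single i 1,
    Pi.single j 1, ?_⟩
  · simp [trace_J, trace_vecMulVec, a, hij]
  · rw [ne_eq]
    refine ne_of_eq_of_ne (diff.lineDeriv_eq_fderiv.symm.trans ?_) hm'
    rw [lineDeriv, funext line]
    simp

end Prescription

section VelocityGradient

variable {n : ℕ}

/-- The matrix of a linear map of `ℝⁿ`, as a continuous linear function of the map. -/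
noncomputable def matrixCLM (n : ℕ) : (Space n →L[ℝ] Space n) →L[ℝ] Matrix (Fin n) (Fin n) ℝ :=
  LinearMap.toContinuousLinearMap
    (toEuclideanCLM (n := Fin n) (𝕜 := ℝ)).symm.toAlgEquiv.toLinearMap

/-- The velocity gradient, with entries `∂_j u^i`. -/
noncomputable def velocityGradient (u : Space n → Space n) (x : Space n) :
    Matrix (Fin n) (Fin n) ℝ :=
  matrixCLM n (fderiv ℝ u x)

theorem toEuclideanCLM_matrixCLM (L : Space n →L[ℝ] Space n) :
    toEuclideanCLM (𝕜 := ℝ) (matrixCLM n L) = L :=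
  (toEuclideanCLM (n := Fin n) (𝕜 := ℝ)).apply_symm_apply L

theorem matrixCLM_comp (L M : Space n →L[ℝ] Space n) :
    matrixCLM n (L.comp M) = matrixCLM n L * matrixCLM n M :=
  map_mul (toEuclideanCLM (n := Fin n) (𝕜 := ℝ)).symm L M

theorem matrixCLM_apply (L : Space n →L[ℝ] Space n) (i j : Fin n) :
    matrixCLM n L i j = L (EuclideanSpace.single j 1) i := by
  conv_rhs => rw [← toEuclideanCLM_matrixCLM L]
  simp

theorem velocityGradient_apply (u : Space n → Space n) (x : Space n) (i j : Fin n) :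
    velocityGradient u x i j = partialDeriv j u x i :=
  matrixCLM_apply _ _ _

theorem of_curl_eq_skewPart (u : Space n → Space n) (x : Space n) :
    of (curl u x) = skewPart (velocityGradient u x) := by
  ext i j
  simp [curl, skewPart_apply, velocityGradient_apply]

theorem divergence_eq_trace (u : Space n → Space n) (x : Space n) :
    divergence u x = (velocityGradient u x).trace := by
  simp [divergence, trace, velocityGradient_apply]

theorem vorticityScalar_eq_scalarForm {m : ℕ} (u : Space (2 * m) → Space (2 * m))
    (x : Space (2 * m)) : vorticityScalar m u x = scalarForm (velocityGradient u x) := by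
  rw [vorticityScalar_eq_scalarForm_curl, of_curl_eq_skewPart, scalarForm_skewPart]

theorem vorticityVector_eq_vectorForm {m : ℕ} (u : Space (2 * m + 1) → Space (2 * m + 1))
    (x : Space (2 * m + 1)) : vorticityVector m u x = vectorForm (velocityGradient u x) := by
  rw [vorticityVector_eq_vectorForm_curl, of_curl_eq_skewPart, vectorForm_skewPart]

theorem hasFDerivAt_velocityGradient {u : Space n → Space n} (hu : ContDiff ℝ 2 u) (x : Space n) :
    HasFDerivAt (velocityGradient u) ((matrixCLM n).comp (fderiv ℝ (fderiv ℝ u) x)) x :=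
  (matrixCLM n).hasFDerivAt.comp x
    ((hu.fderiv_right (m := 1) le_rfl).differentiable (by simp) x).hasFDerivAt

theorem fderiv_fderiv_comm {E F : Type*} [NormedAddCommGroup E] [NormedSpace ℝ E]
    [NormedAddCommGroup F] [NormedSpace ℝ F] {f : E → F} (hf : ContDiff ℝ 2 f) (x v w : E) :
    fderiv ℝ (fderiv ℝ f) x v w = fderiv ℝ (fderiv ℝ f) x w v :=
  hf.contDiffAt.isSymmSndFDerivAt (by simp) v w

theorem gradient_apply (p : Space n → ℝ) (x : Space n) (i : Fin n) :
    gradient p x i = fderiv ℝ p x (EuclideanSpace.single i 1) := by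
  rw [← inner_gradient_left, EuclideanSpace.inner_single_right]
  simp

theorem differentiable_gradient {p : Space n → ℝ} (hp : ContDiff ℝ 2 p) :
    Differentiable ℝ (gradient p) := by
  refine differentiable_euclidean.2 fun i => ?_
  simp only [gradient_apply]
  exact ((hp.fderiv_right (m := 1) le_rfl).differentiable (by simp)).clm_apply
    (differentiable_const _)

theorem velocityGradient_gradient_apply {p : Space n → ℝ} (hp : ContDiff ℝ 2 p) (x : Space n)
    (i j : Fin n) : velocityGradient (gradient p) x i j =
      fderiv ℝ (fderiv ℝ p) x (EuclideanSpace.single j 1) (EuclideanSpace.single i 1) := by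
  have diff := ((hp.fderiv_right (m := 1) le_rfl).differentiable (by simp) x).hasFDerivAt
  have coord : HasFDerivAt (fun y => gradient p y i) _ x :=
    (EuclideanSpace.proj (𝕜 := ℝ) i).hasFDerivAt.comp x (differentiable_gradient hp x).hasFDerivAt
  simp only [gradient_apply] at coord
  have h := coord.unique (diff.clm_apply (hasFDerivAt_const _ x))
  simpa [velocityGradient_apply, partialDeriv] using congr($h (EuclideanSpace.single j 1))

theorem isSymm_velocityGradient_gradient {p : Space n → ℝ} (hp : ContDiff ℝ 2 p) (x : Space n) :
    (velocityGradient (gradient p) x).IsSymm := by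
  ext i j
  rw [transpose_apply, velocityGradient_gradient_apply hp, velocityGradient_gradient_apply hp,
    fderiv_fderiv_comm hp]

theorem matrixCLM_smulRight (p : Space n → ℝ) (x v : Space n) :
    matrixCLM n ((fderiv ℝ p x).smulRight v) = vecMulVec v.ofLp (gradient p x).ofLp := by
  ext i j
  simp [matrixCLM_apply, gradient_apply, vecMulVec_apply, mul_comm]

theorem hasFDerivAt_velocityRate {u : Space n → Space n} {ρ p : Space n → ℝ}
    (hu : ContDiff ℝ 2 u) (hp : ContDiff ℝ 2 p) {x : Space n} (hρ : DifferentiableAt ℝ ρ x)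
    (hρ0 : ρ x ≠ 0) :
    HasFDerivAt (velocityRate u ρ p)
      (-((fderiv ℝ u x).comp (fderiv ℝ u x) + (fderiv ℝ (fderiv ℝ u) x).flip (u x)) -
        ((ρ x)⁻¹ • fderiv ℝ (gradient p) x +
          (-(ρ x ^ 2)⁻¹ • fderiv ℝ ρ x).smulRight (gradient p x))) x :=
  ((((hu.fderiv_right (m := 1) le_rfl).differentiable (by simp) x).hasFDerivAt.clm_apply
    (hu.differentiable (by simp) x).hasFDerivAt).neg.sub
      (((hasDerivAt_inv hρ0).comp_hasFDerivAt x hρ.hasFDerivAt).smul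
        (differentiable_gradient hp x).hasFDerivAt))

theorem velocityGradient_velocityRate_add {u : Space n → Space n} {ρ p : Space n → ℝ}
    (hu : ContDiff ℝ 2 u) (hp : ContDiff ℝ 2 p) {x : Space n} (hρ : DifferentiableAt ℝ ρ x)
    (hρ0 : ρ x ≠ 0) :
    velocityGradient (velocityRate u ρ p) x + fderiv ℝ (velocityGradient u) x (u x) =
      (ρ x ^ 2)⁻¹ • vecMulVec (gradient p x).ofLp (gradient ρ x).ofLp -
        (ρ x)⁻¹ • velocityGradient (gradient p) x -
        velocityGradient u x * velocityGradient u x := by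
  rw [velocityGradient, (hasFDerivAt_velocityRate hu hp hρ hρ0).fderiv,
    (hasFDerivAt_velocityGradient hu x).fderiv]
  have symm_snd : (fderiv ℝ (fderiv ℝ u) x).flip (u x) = fderiv ℝ (fderiv ℝ u) x (u x) :=
    ContinuousLinearMap.ext fun w => fderiv_fderiv_comm hu x w (u x)
  have rank_one : (-(ρ x ^ 2)⁻¹ • fderiv ℝ ρ x).smulRight (gradient p x) =
      -(ρ x ^ 2)⁻¹ • (fderiv ℝ ρ x).smulRight (gradient p x) := by
    ext w
    simp [mul_assoc]
  rw [symm_snd, rank_one]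
  simp only [map_sub, map_neg, map_add, map_smul, matrixCLM_comp,
    matrixCLM_smulRight, ContinuousLinearMap.comp_apply, velocityGradient,
    neg_smul]
  abel

end VelocityGradient

/-! ### Conservation as an identity in the first derivatives of the fields -/

section LocalBalance

variable {n : ℕ} {G V : Type*} [NormedAddCommGroup G] [NormedSpace ℝ G] [NormedAddCommGroup V]
  [NormedSpace ℝ V]

theorem divergence_smul {g : Space n → ℝ} {u : Space n → Space n} {x : Space n}
    (hg : DifferentiableAt ℝ g x) (hu : DifferentiableAt ℝ u x) :
    divergence (fun y => g y • u y) x = fderiv ℝ g x (u x) + g x * divergence u x := by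
  have coords : u x = ∑ i, u x i • EuclideanSpace.single i (1 : ℝ) := by
    simpa using ((EuclideanSpace.basisFun (Fin n) ℝ).sum_repr (u x)).symm
  conv_rhs => rw [coords]
  simp only [divergence, partialDeriv, fderiv_fun_smul hg hu, map_sum, map_smul, Finset.mul_sum,
    ← Finset.sum_add_distrib]
  refine Finset.sum_congr rfl fun i _ => ?_
  simp only [_root_.add_apply, _root_.smul_apply, ContinuousLinearMap.smulRight_apply,
    PiLp.add_apply, PiLp.smul_apply, smul_eq_mul]
  ring

theorem velocityGradient_add_smul {u v : Space n → Space n} {x : Space n}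
    (hu : DifferentiableAt ℝ u x) (hv : DifferentiableAt ℝ v x) (τ : ℝ) :
    velocityGradient (fun y => u y + τ • v y) x =
      velocityGradient u x + τ • velocityGradient v x := by
  simp only [velocityGradient, fderiv_fun_add hu (hv.fun_const_smul τ), fderiv_fun_const_smul hv,
    map_add, map_smul]

variable {rate : (Space n → Space n × G) → Space n → Space n × G}
  {vort : (Space n → Space n) → Space n → V} {F : Matrix (Fin n) (Fin n) ℝ → V}
  {T : Space n × G → V → ℝ} {q : Space n → Space n × G} {x : Space n} {A : Matrix (Fin n) (Fin n) ℝ}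

theorem timeDeriv_eq (hvort : ∀ u x, vort u x = F (velocityGradient u x))
    (hA : velocityGradient (fun y => (q y).1) x = A) (hF : DifferentiableAt ℝ F A)
    (hT : DifferentiableAt ℝ (Function.uncurry T) (q x, F A))
    (hq : DifferentiableAt ℝ q x) (hrate : DifferentiableAt ℝ (fun y => (rate q y).1) x) :
    timeDeriv rate vort T q x = fderiv ℝ (Function.uncurry T) (q x, F A)
      (rate q x, fderiv ℝ F A (velocityGradient (fun y => (rate q y).1) x)) := by
  set B := velocityGradient (fun y => (rate q y).1) x
  have gradient_add (τ : ℝ) :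
      velocityGradient (fun y => (q y + τ • rate q y).1) x = A + τ • B := by
    simp only [Prod.fst_add, Prod.smul_fst, velocityGradient_add_smul hq.fst hrate, hA, B]
  have line_q : HasDerivAt (fun τ : ℝ => q x + τ • rate q x) (rate q x) 0 := by
    simpa using ((hasDerivAt_id' (0 : ℝ)).smul_const (rate q x)).const_add (q x)
  have line_A : HasDerivAt (fun τ : ℝ => A + τ • B) ((1 : ℝ) • B) 0 :=
    ((hasDerivAt_id' (0 : ℝ)).smul_const B).const_add A
  rw [one_smul] at line_A
  have line_F := hF.hasFDerivAt.comp_hasDerivAt_of_eq 0 line_A (by simp)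
  have h := hT.hasFDerivAt.comp_hasDerivAt_of_eq 0 (line_q.prodMk line_F) (by simp)
  simp only [timeDeriv, densityAt, hvort, gradient_add]
  exact h.deriv

theorem hasFDerivAt_densityAt (hvort : ∀ u x, vort u x = F (velocityGradient u x))
    (hA : velocityGradient (fun y => (q y).1) x = A) (hF : DifferentiableAt ℝ F A)
    (hT : DifferentiableAt ℝ (Function.uncurry T) (q x, F A)) (hq : ContDiff ℝ 2 q) :
    HasFDerivAt (densityAt vort T q) ((fderiv ℝ (Function.uncurry T) (q x, F A)).comp
      ((fderiv ℝ q x).prod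
        ((fderiv ℝ F A).comp (fderiv ℝ (velocityGradient fun y => (q y).1) x)))) x := by
  subst hA
  have grad := (hasFDerivAt_velocityGradient (contDiff_fst.comp hq) x).differentiableAt.hasFDerivAt
  have h := hT.hasFDerivAt.comp x
    ((hq.differentiable (by simp) x).hasFDerivAt.prodMk (hF.hasFDerivAt.comp x grad))
  refine h.congr_of_eventuallyEq (.of_forall fun y => ?_)
  simp [densityAt, hvort]

theorem timeDeriv_add_divergence (hvort : ∀ u x, vort u x = F (velocityGradient u x))
    (hA : velocityGradient (fun y => (q y).1) x = A) (hF : DifferentiableAt ℝ F A)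
    (hT : DifferentiableAt ℝ (Function.uncurry T) (q x, F A))
    (hq : ContDiff ℝ 2 q) (hrate : DifferentiableAt ℝ (fun y => (rate q y).1) x) :
    timeDeriv rate vort T q x + divergence (fun y => densityAt vort T q y • (q y).1) x =
      fderiv ℝ (Function.uncurry T) (q x, F A) (rate q x + fderiv ℝ q x (q x).1,
        fderiv ℝ F A (velocityGradient (fun y => (rate q y).1) x +
          fderiv ℝ (velocityGradient fun y => (q y).1) x (q x).1)) +
      T (q x) (F A) * A.trace := by
  have diff_q := hq.differentiable (by simp) x
  have density := hasFDerivAt_densityAt hvort hA hF hT hq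
  rw [divergence_smul density.differentiableAt diff_q.fst, density.fderiv,
    timeDeriv_eq hvort hA hF hT diff_q hrate, divergence_eq_trace, hA, densityAt, hvort, hA,
    ← add_assoc, ContinuousLinearMap.comp_apply, ← map_add]
  simp

end LocalBalance

section EulerIdentity

variable {n : ℕ} {V : Type*} [NormedAddCommGroup V] [NormedSpace ℝ V]

theorem isOpen_physical : IsOpen (physical n) :=
  isOpen_lt continuous_const continuous_snd.fst

theorem IsConservedOnMovingDomains.differentiableAt {G : Type*} [NormedAddCommGroup G]
    [NormedSpace ℝ G] {Ω : Set (Space n × G)} (hΩ : IsOpen Ω)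
    {rate : (Space n → Space n × G) → Space n → Space n × G}
    {vort : (Space n → Space n) → Space n → V} {T : Space n × G → V → ℝ}
    (hT : IsConservedOnMovingDomains Ω rate vort T) {s : Space n × G} (hs : s ∈ Ω) (w : V) :
    DifferentiableAt ℝ (Function.uncurry T) (s, w) :=
  (hT.1.contDiffAt ((hΩ.preimage continuous_fst).mem_nhds hs)).differentiableAt (by simp)

theorem eulerRate_add_fderiv (P : ℝ → ℝ → ℝ) {u : Space n → Space n} {ρ S : Space n → ℝ}
    {x : Space n} (hu : DifferentiableAt ℝ u x) (hρ : DifferentiableAt ℝ ρ x)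
    (hS : DifferentiableAt ℝ S x) :
    eulerRate P (fun y => (u y, ρ y, S y)) x + fderiv ℝ (fun y => (u y, ρ y, S y)) x (u x) =
      (-((ρ x)⁻¹ • gradient (fun y => P (ρ y) (S y)) x),
        -(ρ x * (velocityGradient u x).trace), 0) := by
  rw [hu.fderiv_prodMk (hρ.prodMk hS), hρ.fderiv_prodMk hS, ← divergence_eq_trace]
  ext1
  · simp only [eulerRate, velocityRate, Prod.fst_add, ContinuousLinearMap.prod_apply]
    abel
  · simp [eulerRate, densityRate, entropyRate, divergence_smul hρ hu]

theorem timeDeriv_eulerRate_add_divergence {vort : (Space n → Space n) → Space n → V}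
    {F : Matrix (Fin n) (Fin n) ℝ → V} (hvort : ∀ u x, vort u x = F (velocityGradient u x))
    (hskew : ∀ A, F (skewPart A) = F A) {P : ℝ → ℝ → ℝ} {T : Space n × ℝ × ℝ → V → ℝ}
    {u : Space n → Space n} {ρ S : Space n → ℝ} {x : Space n} {A : Matrix (Fin n) (Fin n) ℝ}
    (hA : velocityGradient u x = A) (hu : ContDiff ℝ 2 u) (hρ : ContDiff ℝ 2 ρ)
    (hS : ContDiff ℝ 2 S) (hp : ContDiff ℝ 2 fun y => P (ρ y) (S y)) (hρ0 : ρ x ≠ 0)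
    (hF : DifferentiableAt ℝ F A)
    (hT : DifferentiableAt ℝ (Function.uncurry T) ((u x, ρ x, S x), F A)) :
    timeDeriv (eulerRate P) vort T (fun y => (u y, ρ y, S y)) x +
        divergence (fun y => densityAt vort T (fun y => (u y, ρ y, S y)) y • u y) x =
      fderiv ℝ (Function.uncurry T) ((u x, ρ x, S x), F A)
        ((-((ρ x)⁻¹ • gradient (fun y => P (ρ y) (S y)) x), -(ρ x * A.trace), 0),
          (ρ x ^ 2)⁻¹ • fderiv ℝ F A (vecMulVec (gradient (fun y => P (ρ y) (S y)) x).ofLp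
            (gradient ρ x).ofLp) - fderiv ℝ F A (A * A)) +
      T (u x, ρ x, S x) (F A) * A.trace := by
  have du := hu.differentiable (by simp) x
  have dρ := hρ.differentiable (by simp) x
  have diff_v := (hasFDerivAt_velocityRate hu hp dρ hρ0).differentiableAt
  refine (timeDeriv_add_divergence (q := fun y => (u y, ρ y, S y)) (rate := eulerRate P) hvort hA
    hF hT (hu.prodMk (hρ.prodMk hS)) diff_v).trans ?_
  rw [eulerRate_add_fderiv P du dρ (hS.differentiable (by simp) x)]
  have advected := velocityGradient_velocityRate_add hu hp dρ hρ0
  rw [hA] at advected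
  have hessian := fderiv_eq_zero_of_isSymm hskew hF (isSymm_velocityGradient_gradient hp x)
  have advected_F := congrArg (fderiv ℝ F A) advected
  rw [map_sub, map_sub, map_smul, map_smul, hessian, smul_zero, sub_zero] at advected_F
  rw [hA, ← advected_F]
  rfl

theorem hasGradientAt_pressure {P : ℝ → ℝ → ℝ} {ρ S : Space n → ℝ} {x g s : Space n}
    (hP : DifferentiableAt ℝ (Function.uncurry P) (ρ x, S x)) (hρ : HasGradientAt ρ g x)
    (hS : HasGradientAt S s x) :
    HasGradientAt (fun y => P (ρ y) (S y))
      (deriv (P · (S x)) (ρ x) • g + deriv (P (ρ x)) (S x) • s) x := by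
  set L := fderiv ℝ (Function.uncurry P) (ρ x, S x)
  have line_fst : HasDerivAt (fun r : ℝ => (r, S x)) (1, 0) (ρ x) :=
    (hasDerivAt_id' _).prodMk (hasDerivAt_const _ _)
  have line_snd : HasDerivAt (fun t : ℝ => (ρ x, t)) (0, 1) (S x) :=
    (hasDerivAt_const _ _).prodMk (hasDerivAt_id' _)
  have chain_fst := hP.hasFDerivAt.comp_hasDerivAt (ρ x) line_fst
  have chain_snd := hP.hasFDerivAt.comp_hasDerivAt (S x) line_snd
  have chain := hP.hasFDerivAt.comp x (hρ.hasFDerivAt.prodMk hS.hasFDerivAt)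
  refine HasFDerivAt.congr_fderiv chain (ContinuousLinearMap.ext fun w => ?_)
  have split : (inner ℝ g w, inner ℝ s w) =
      inner ℝ g w • ((1 : ℝ), (0 : ℝ)) + inner ℝ s w • ((0 : ℝ), (1 : ℝ)) := by simp
  change L (inner ℝ g w, inner ℝ s w) =
    inner ℝ (deriv (P · (S x)) (ρ x) • g + deriv (P (ρ x)) (S x) • s) w
  rw [split, map_add, map_smul, map_smul, ← chain_fst.deriv, ← chain_snd.deriv, inner_add_left,
    real_inner_smul_left, real_inner_smul_left, smul_eq_mul, smul_eq_mul, mul_comm,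
    mul_comm (inner ℝ s w)]
  rfl

theorem velocityGradient_affine (u₀ x : Space n) (A : Matrix (Fin n) (Fin n) ℝ) :
    velocityGradient (fun y => u₀ + toEuclideanCLM (𝕜 := ℝ) A y) x = A := by
  rw [velocityGradient, fderiv_const_add, ContinuousLinearMap.fderiv]
  exact (toEuclideanCLM (n := Fin n) (𝕜 := ℝ)).symm_apply_apply A

theorem hasGradientAt_affine (c : ℝ) (s x : Space n) :
    HasGradientAt (fun y => c + inner ℝ s y) s x :=
  ((innerSL ℝ s).hasFDerivAt).const_add c

theorem hasGradientAt_mul_exp {c : ℝ} (hc : c ≠ 0) (g : Space n) :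
    HasGradientAt (fun y => c * Real.exp (inner ℝ g y / c)) g 0 := by
  have h := (((innerSL ℝ g).hasFDerivAt (x := 0)).mul_const c⁻¹).exp.const_mul c
  refine HasFDerivAt.congr_fderiv h (ContinuousLinearMap.ext fun w => ?_)
  simp [hc]

theorem IsConservedOnMovingDomains.euler_identity {P : ℝ → ℝ → ℝ}
    (hP : ContDiffOn ℝ ∞ (fun z : ℝ × ℝ => P z.1 z.2) {z | 0 < z.1})
    {vort : (Space n → Space n) → Space n → V} {F : Matrix (Fin n) (Fin n) ℝ → V}
    (hvort : ∀ u x, vort u x = F (velocityGradient u x)) (hskew : ∀ A, F (skewPart A) = F A)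
    (hF : Differentiable ℝ F) {T : Space n × ℝ × ℝ → V → ℝ}
    (hT : IsConservedOnMovingDomains (physical n) (eulerRate P) vort T)
    (u₀ : Space n) {ρ₀ : ℝ} (hρ₀ : 0 < ρ₀) (S₀ : ℝ) (A : Matrix (Fin n) (Fin n) ℝ)
    (g s : Space n) :
    fderiv ℝ (Function.uncurry T) ((u₀, ρ₀, S₀), F A)
        ((-(ρ₀⁻¹ • (deriv (P · S₀) ρ₀ • g + deriv (P ρ₀) S₀ • s)), -(ρ₀ * A.trace), 0),
          ((ρ₀ ^ 2)⁻¹ * deriv (P ρ₀) S₀) • fderiv ℝ F A (vecMulVec s.ofLp g.ofLp) -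
            fderiv ℝ F A (A * A)) +
      T (u₀, ρ₀, S₀) (F A) * A.trace = 0 := by
  set u := fun y => u₀ + toEuclideanCLM (𝕜 := ℝ) A y
  set ρ : Space n → ℝ := fun y => ρ₀ * Real.exp (inner ℝ g y / ρ₀) with ρ_def
  set S : Space n → ℝ := fun y => S₀ + inner ℝ s y with S_def
  have hu : ContDiff ℝ ∞ u := by fun_prop
  have hρ : ContDiff ℝ ∞ ρ :=
    contDiff_const.mul (((innerSL ℝ g).contDiff.div_const ρ₀).exp)
  have hS : ContDiff ℝ ∞ S := contDiff_const.add (innerSL ℝ s).contDiff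
  have ρ_pos (y) : 0 < ρ y := mul_pos hρ₀ (Real.exp_pos _)
  have hp : ContDiff ℝ ∞ fun y => P (ρ y) (S y) := hP.comp_contDiff (hρ.prodMk hS) ρ_pos
  have ρ_zero : ρ 0 = ρ₀ := by simp [ρ_def]
  have S_zero : S 0 = S₀ := by simp [S_def]
  have two_le : (2 : ℕ∞ω) ≤ ∞ := WithTop.coe_le_coe.2 le_top
  have grad_ρ := hasGradientAt_mul_exp hρ₀.ne' g
  have diff_P : DifferentiableAt ℝ (Function.uncurry P) (ρ 0, S 0) :=
    (hP.contDiffAt ((isOpen_lt continuous_const continuous_fst).mem_nhds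
      (ρ_pos 0))).differentiableAt (by simp)
  have balance := timeDeriv_eulerRate_add_divergence hvort hskew (P := P)
    (velocityGradient_affine u₀ 0 A) (hu.of_le two_le) (hρ.of_le two_le) (hS.of_le two_le)
    (hp.of_le two_le) (ρ_pos 0).ne' (hF A) (hT.differentiableAt isOpen_physical (ρ_pos 0) _)
  rw [hT.2 (fun y => (u y, ρ y, S y)) ⟨hu.prodMk (hρ.prodMk hS), ρ_pos⟩ 0,
    (hasGradientAt_pressure diff_P grad_ρ (hasGradientAt_affine S₀ s 0)).gradient,
    grad_ρ.gradient] at balance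
  have symm_part : fderiv ℝ F A (vecMulVec g.ofLp g.ofLp) = 0 :=
    fderiv_eq_zero_of_isSymm hskew (hF A) (transpose_vecMulVec _ _)
  simpa only [map_zero, add_zero, ρ_zero, S_zero, WithLp.ofLp_add, WithLp.ofLp_smul, add_vecMulVec,
    smul_vecMulVec, map_add, map_smul, symm_part, smul_zero, zero_add, smul_smul] using balance.symm

end EulerIdentity

/-! ### Consequences for the density -/

section VorticityDerivative

variable {n : ℕ} {G V : Type*} [NormedAddCommGroup G] [NormedSpace ℝ G] [NormedAddCommGroup V]
  [NormedSpace ℝ V]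

theorem fderiv_apply_vorticity {T : Space n × G → V → ℝ} {s : Space n × G} {w : V}
    (hT : DifferentiableAt ℝ (Function.uncurry T) (s, w)) (v : V) :
    fderiv ℝ (T s) w v = fderiv ℝ (Function.uncurry T) (s, w) (0, v) :=
  congr($((hT.hasFDerivAt.comp w (hasFDerivAt_prodMk_right s w)).fderiv) v)

theorem IsConservedOnMovingDomains.contDiff_vorticity {Ω : Set (Space n × G)}
    {rate : (Space n → Space n × G) → Space n → Space n × G}
    {vort : (Space n → Space n) → Space n → V} {T : Space n × G → V → ℝ}
    (hT : IsConservedOnMovingDomains Ω rate vort T) {s : Space n × G} (hs : s ∈ Ω) :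
    ContDiff ℝ ∞ (T s) :=
  hT.1.comp_contDiff (contDiff_const.prodMk contDiff_id) fun _ => hs

end VorticityDerivative

section Odd

variable {m : ℕ}

theorem IsConservedOnMovingDomains.fderiv_apply_toEuclideanCLM {P : ℝ → ℝ → ℝ}
    (hP : ContDiffOn ℝ ∞ (fun z : ℝ × ℝ => P z.1 z.2) {z | 0 < z.1})
    {T : Space (2 * m + 1) × ℝ × ℝ → Space (2 * m + 1) → ℝ}
    (hT : IsConservedOnMovingDomains (physical (2 * m + 1)) (eulerRate P) (vorticityVector m) T)
    {s : Space (2 * m + 1) × ℝ × ℝ} (hs : s ∈ physical (2 * m + 1))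
    {A : Matrix (Fin (2 * m + 1)) (Fin (2 * m + 1)) ℝ} (hA : A.trace = 0) :
    fderiv ℝ (T s) (vectorForm A) (toEuclideanCLM (𝕜 := ℝ) A (vectorForm A)) = 0 := by
  have h := hT.euler_identity hP vorticityVector_eq_vectorForm vectorForm_skewPart
    (contDiff_vectorForm.differentiable (by simp)) s.1 hs s.2.2 A 0 0
  rw [fderiv_apply_vorticity (hT.differentiableAt isOpen_physical hs _)]
  simpa [hA, fderiv_vectorForm_mul_self, ← Prod.zero_eq_mk] using h

theorem IsConservedOnMovingDomains.isVorticityIndependent_of_odd {P : ℝ → ℝ → ℝ}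
    (hP : ContDiffOn ℝ ∞ (fun z : ℝ × ℝ => P z.1 z.2) {z | 0 < z.1}) (hm : 1 ≤ m)
    {T : Space (2 * m + 1) × ℝ × ℝ → Space (2 * m + 1) → ℝ}
    (hT : IsConservedOnMovingDomains (physical (2 * m + 1)) (eulerRate P) (vorticityVector m) T) :
    IsVorticityIndependent (physical (2 * m + 1)) T := by
  intro s hs
  have smooth := hT.contDiff_vorticity hs
  have zero_of_ne : ∀ v : Space (2 * m + 1), v 0 ≠ 0 → fderiv ℝ (T s) v = 0 := fun v hv => by
    ext y
    obtain ⟨A, trace_A, rfl, rfl⟩ := exists_vectorForm_eq_apply_eq hm hv y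
    exact hT.fderiv_apply_toEuclideanCLM hP hs trace_A
  have zero : fderiv ℝ (T s) = 0 :=
    Continuous.ext_on (dense_apply_ne_zero 0) (smooth.continuous_fderiv (by simp))
      continuous_const zero_of_ne
  exact is_const_of_fderiv_eq_zero (smooth.differentiable (by simp)) (congrFun zero)

end Odd

section Even

variable {m : ℕ} {P : ℝ → ℝ → ℝ}
  (hP : ContDiffOn ℝ ∞ (fun z : ℝ × ℝ => P z.1 z.2) {z | 0 < z.1})
  {T : Space (2 * m) × ℝ × ℝ → ℝ → ℝ}
  (hT : IsConservedOnMovingDomains (physical (2 * m)) (eulerRate P) (vorticityScalar m) T)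

include hP hT

theorem IsConservedOnMovingDomains.scalar_euler_identity (u : Space (2 * m)) {ρ : ℝ} (hρ : 0 < ρ)
    (S : ℝ) (A : Matrix (Fin (2 * m)) (Fin (2 * m)) ℝ) (g s : Space (2 * m)) :
    fderiv ℝ (Function.uncurry T) ((u, ρ, S), scalarForm A)
        ((-(ρ⁻¹ • (deriv (P · S) ρ • g + deriv (P ρ) S • s)), -(ρ * A.trace), 0),
          (ρ ^ 2)⁻¹ * deriv (P ρ) S * fderiv ℝ scalarForm A (vecMulVec s.ofLp g.ofLp) -
            A.trace * scalarForm A) +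
      T (u, ρ, S) (scalarForm A) * A.trace = 0 := by
  have h := hT.euler_identity hP vorticityScalar_eq_scalarForm scalarForm_skewPart
    (contDiff_scalarForm.differentiable (by simp)) u hρ S A g s
  rwa [fderiv_scalarForm_mul_self, smul_eq_mul] at h

theorem IsConservedOnMovingDomains.fderiv_density_vorticity (hm : 1 ≤ m) (u : Space (2 * m))
    {ρ : ℝ} (hρ : 0 < ρ) (S ϖ : ℝ) :
    fderiv ℝ (Function.uncurry T) ((u, ρ, S), ϖ) ((0, ρ, 0), ϖ) = T (u, ρ, S) ϖ := by
  obtain ⟨A, trace_A, rfl, -⟩ := exists_scalarForm_eq hm 1 ϖ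
  have h := hT.scalar_euler_identity hP u hρ S A 0 0
  have neg : ((0, -ρ, 0), -scalarForm A) =
      -(((0, ρ, 0), scalarForm A) : (Space (2 * m) × ℝ × ℝ) × ℝ) := by simp
  simp only [trace_A, map_zero, smul_zero, add_zero, neg_zero, mul_one, one_mul,
    WithLp.ofLp_zero, vecMulVec_zero, mul_zero, zero_sub, neg] at h
  rwa [map_neg, neg_add_eq_zero] at h

theorem IsConservedOnMovingDomains.homogeneous (hm : 1 ≤ m) (u : Space (2 * m)) {ρ : ℝ}
    (hρ : 0 < ρ) (S ϖ : ℝ) {c : ℝ} (hc : 0 < c) :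
    T (u, c * ρ, S) (c * ϖ) = c * T (u, ρ, S) ϖ := by
  have quotient (t : ℝ) (ht : 0 < t) :
      HasDerivAt (fun t : ℝ => T (u, t * ρ, S) (t * ϖ) / t) 0 t := by
    have line : HasDerivAt (fun t : ℝ => ((u, t * ρ, S), t * ϖ)) ((0, ρ, 0), ϖ) t :=
      ((hasDerivAt_const t u).prodMk
        ((hasDerivAt_mul_const ρ).prodMk (hasDerivAt_const t S))).prodMk (hasDerivAt_mul_const ϖ)
    have along := (hT.differentiableAt isOpen_physical (s := (u, t * ρ, S)) (mul_pos ht hρ)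
      (t * ϖ)).hasFDerivAt.comp_hasDerivAt t line
    have euler := hT.fderiv_density_vorticity hP hm u (mul_pos ht hρ) S (t * ϖ)
    have smul : ((0, t * ρ, 0), t * ϖ) =
        t • (((0, ρ, 0), ϖ) : (Space (2 * m) × ℝ × ℝ) × ℝ) := by simp
    rw [smul, map_smul, smul_eq_mul] at euler
    refine (along.div (hasDerivAt_id' t) ht.ne').congr_deriv ?_
    rw [mul_comm, euler]
    simp
  have const := isOpen_Ioi.is_const_of_deriv_eq_zero isPreconnected_Ioi
    (fun t ht => (quotient t ht).differentiableAt.differentiableWithinAt)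
    (fun t ht => (quotient t ht).deriv) (Set.mem_Ioi.2 hc) (Set.mem_Ioi.2 one_pos)
  simpa [div_eq_iff hc.ne', mul_comm] using const

theorem IsConservedOnMovingDomains.eq_mul_div (hm : 1 ≤ m) (u : Space (2 * m)) {ρ r : ℝ}
    (hρ : 0 < ρ) (hr : 0 < r) (S ϖ : ℝ) :
    T (u, ρ, S) ϖ = ρ / r * T (u, r, S) (ϖ * r / ρ) := by
  rw [← hT.homogeneous hP hm u hr S _ (div_pos hρ hr)]
  field_simp

theorem IsConservedOnMovingDomains.vorticity_eq_of_deriv_entropy_ne_zero (hm : 1 ≤ m)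
    (u : Space (2 * m)) {ρ : ℝ} (hρ : 0 < ρ) {S : ℝ} (hPS : deriv (P ρ) S ≠ 0) (ϖ ϖ' : ℝ) :
    T (u, ρ, S) ϖ = T (u, ρ, S) ϖ' := by
  have hs : (u, ρ, S) ∈ physical (2 * m) := hρ
  refine is_const_of_fderiv_eq_zero (𝕜 := ℝ)
    ((hT.contDiff_vorticity hs).differentiable (by simp)) (fun ϖ => ?_) ϖ ϖ'
  obtain ⟨A, trace_A, rfl, a, b, hab⟩ := exists_scalarForm_eq hm 0 ϖ
  set L := fderiv ℝ (Function.uncurry T) ((u, ρ, S), scalarForm A)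
  set c := (ρ ^ 2)⁻¹ * deriv (P ρ) S * fderiv ℝ scalarForm A (vecMulVec a b)
  obtain ⟨v, v_def⟩ : ∃ v, v =
    ρ⁻¹ • (deriv (P · S) ρ • WithLp.toLp 2 b + deriv (P ρ) S • WithLp.toLp 2 a) := ⟨_, rfl⟩
  have plus : L ((-v, 0, 0), c) = 0 := by
    have h := hT.scalar_euler_identity hP u hρ S A (WithLp.toLp 2 b) (WithLp.toLp 2 a)
    rw [← v_def, trace_A] at h
    simpa using h
  have minus : L ((v, 0, 0), c) = 0 := by
    have h := hT.scalar_euler_identity hP u hρ S A (-WithLp.toLp 2 b) (-WithLp.toLp 2 a)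
    rw [smul_neg, smul_neg, ← neg_add, smul_neg, ← v_def, trace_A] at h
    simpa using h
  have sum : L (0, 2 * c) = 0 := by
    have h := congrArg₂ (· + ·) plus minus
    simpa [← map_add, two_mul, ← Prod.zero_eq_mk] using h
  have hc : 2 * c ≠ 0 :=
    mul_ne_zero two_ne_zero (mul_ne_zero (mul_ne_zero (inv_ne_zero (by positivity)) hPS) hab)
  rw [← fderiv_apply_vorticity (hT.differentiableAt isOpen_physical hs _)] at sum
  have scaled := (fderiv ℝ (T (u, ρ, S)) (scalarForm A)).map_smul (2 * c) 1
  rw [smul_eq_mul, mul_one, sum, eq_comm] at scaled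
  exact ContinuousLinearMap.ext_ring ((smul_eq_zero.1 scaled).resolve_left hc)

theorem IsConservedOnMovingDomains.velocity_eq_of_deriv_density_ne_zero (hm : 1 ≤ m) {ρ : ℝ}
    (hρ : 0 < ρ) {S : ℝ} (hPρ : deriv (P · S) ρ ≠ 0) (u u' : Space (2 * m)) (ϖ : ℝ) :
    T (u, ρ, S) ϖ = T (u', ρ, S) ϖ := by
  have chain (u : Space (2 * m)) :=
    HasFDerivAt.comp (g := Function.uncurry T) (f := fun u => ((u, ρ, S), ϖ)) u
      (hT.differentiableAt isOpen_physical (s := (u, ρ, S)) hρ ϖ).hasFDerivAt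
      (((hasFDerivAt_id u).prodMk (hasFDerivAt_const (ρ, S) u)).prodMk (hasFDerivAt_const ϖ u))
  refine is_const_of_fderiv_eq_zero (𝕜 := ℝ) (fun u => (chain u).differentiableAt)
    (fun u => (chain u).fderiv.trans (ContinuousLinearMap.ext fun v => ?_)) u u'
  obtain ⟨A, trace_A, rfl, -⟩ := exists_scalarForm_eq hm 0 ϖ
  have h := hT.scalar_euler_identity hP u hρ S A (-((ρ * (deriv (P · S) ρ)⁻¹) • v)) 0
  have scale : ρ⁻¹ * (deriv (P · S) ρ * (ρ * (deriv (P · S) ρ)⁻¹)) = 1 := by field_simp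
  simpa [trace_A, smul_smul, scale, ← Prod.zero_eq_mk] using h

end Even

theorem IsNonIsentropicEOS.dense {P : ℝ → ℝ → ℝ} (hP : IsNonIsentropicEOS P) :
    Dense {S : ℝ | ∃ ρ > 0, deriv (P ρ) S ≠ 0} :=
  dense_iff_exists_between.2 fun a b hab =>
    let ⟨S, hS, h⟩ := hP.2 a b hab
    ⟨S, h, hS⟩

theorem IsConservedOnMovingDomains.isVorticityIndependent_of_even {P : ℝ → ℝ → ℝ}
    (hP : IsNonIsentropicEOS P) {m : ℕ} (hm : 1 ≤ m) {T : Space (2 * m) × ℝ × ℝ → ℝ → ℝ}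
    (hT : IsConservedOnMovingDomains (physical (2 * m)) (eulerRate P) (vorticityScalar m) T) :
    IsVorticityIndependent (physical (2 * m)) T := by
  rintro ⟨u, ρ, S⟩ (hρ : 0 < ρ) ϖ ϖ'
  have continuous_entropy (w : ℝ) : Continuous fun S => T (u, ρ, S) w :=
    (hT.1.comp_contDiff ((contDiff_const.prodMk (contDiff_const.prodMk contDiff_id)).prodMk
      contDiff_const) fun _ => hρ).continuous
  refine congrFun (Continuous.ext_on hP.dense (continuous_entropy ϖ) (continuous_entropy ϖ') ?_) S
  rintro S ⟨r, hr, hPS⟩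
  change T (u, ρ, S) ϖ = T (u, ρ, S) ϖ'
  rw [hT.eq_mul_div hP.1 hm u hρ hr, hT.eq_mul_div hP.1 hm u hρ hr S ϖ',
    hT.vorticity_eq_of_deriv_entropy_ne_zero hP.1 hm u hr hPS]

section Isentropic

variable {n : ℕ} {V : Type*} [NormedAddCommGroup V] [NormedSpace ℝ V]
  {vort : (Space n → Space n) → Space n → V} {P : ℝ → ℝ}

theorem contDiffOn_extend_entropy (hP : ContDiffOn ℝ ∞ P (Set.Ioi 0)) :
    ContDiffOn ℝ ∞ (fun z : ℝ × ℝ => P z.1) {z | 0 < z.1} :=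
  hP.comp contDiffOn_fst fun _ hz => hz

theorem contDiffOn_physical_of_isentropicPhysical {T : Space n × ℝ → V → ℝ}
    (hT : ContDiffOn ℝ ∞ (fun z : (Space n × ℝ) × V => T z.1 z.2)
      {z | z.1 ∈ isentropicPhysical n}) :
    ContDiffOn ℝ ∞ (fun z : (Space n × ℝ × ℝ) × V => T (z.1.1, z.1.2.1) z.2)
      {z | z.1 ∈ physical n} :=
  hT.comp (f := fun z : (Space n × ℝ × ℝ) × V => ((z.1.1, z.1.2.1), z.2))
    (by fun_prop) fun _ hz => hz

theorem isConservedOnMovingDomains_isentropic_iff {T : Space n × ℝ → V → ℝ} :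
    IsConservedOnMovingDomains (isentropicPhysical n) (isentropicRate P) vort T ↔
      IsConservedOnMovingDomains (physical n) (eulerRate fun ρ _ => P ρ) vort
        fun s => T (s.1, s.2.1) := by
  constructor
  · rintro ⟨smooth, balance⟩
    refine ⟨contDiffOn_physical_of_isentropicPhysical smooth, fun q hq x => ?_⟩
    exact balance (fun y => ((q y).1, (q y).2.1)) ⟨hq.1.fst.prodMk hq.1.snd.fst, hq.2⟩ x
  · rintro ⟨smooth, balance⟩
    refine ⟨smooth.comp (f := fun z : (Space n × ℝ) × V => ((z.1.1, z.1.2, 0), z.2))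
      (by fun_prop) fun z hz => hz, fun q hq x => ?_⟩
    exact balance (fun y => ((q y).1, (q y).2, 0))
      ⟨hq.1.fst.prodMk (hq.1.snd.prodMk contDiff_const), hq.2⟩ x

theorem IsConservedOnMovingDomains.isVorticityIndependent_of_odd_isentropic
    (hP : ContDiffOn ℝ ∞ P (Set.Ioi 0)) {m : ℕ} (hm : 1 ≤ m)
    {T : Space (2 * m + 1) × ℝ → Space (2 * m + 1) → ℝ}
    (hT : IsConservedOnMovingDomains (isentropicPhysical (2 * m + 1)) (isentropicRate P)
      (vorticityVector m) T) :
    IsVorticityIndependent (isentropicPhysical (2 * m + 1)) T := fun s hs =>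
  (isConservedOnMovingDomains_isentropic_iff.1 hT).isVorticityIndependent_of_odd
    (contDiffOn_extend_entropy hP) hm (s.1, s.2, 0) hs

theorem IsConservedOnMovingDomains.exists_isEnstrophyDensity (hP : IsIsentropicEOS P) {m : ℕ}
    (hm : 1 ≤ m) {T : Space (2 * m) × ℝ → ℝ → ℝ}
    (hT : IsConservedOnMovingDomains (isentropicPhysical (2 * m)) (isentropicRate P)
      (vorticityScalar m) T) : ∃ f : ℝ → ℝ, ContDiff ℝ ∞ f ∧ IsEnstrophyDensity f T := by
  obtain ⟨smooth, r, hr, hPr⟩ := hP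
  have hT' := isConservedOnMovingDomains_isentropic_iff.1 hT
  have smooth' := contDiffOn_extend_entropy smooth
  refine ⟨T (0, 1), hT.contDiff_vorticity (zero_lt_one (α := ℝ)), fun u ρ ϖ hρ => ?_⟩
  calc T (u, ρ) ϖ = ρ / r * T (u, r) (ϖ * r / ρ) := hT'.eq_mul_div smooth' hm u hρ hr 0 ϖ
    _ = ρ / r * T (0, r) (ϖ * r / ρ) := by
      rw [hT'.velocity_eq_of_deriv_density_ne_zero smooth' hm hr (S := 0) hPr u 0]
    _ = T (0, ρ) ϖ := (hT'.eq_mul_div smooth' hm 0 hρ hr 0 ϖ).symm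
    _ = ρ * T (0, 1) (ϖ / ρ) := by
      simpa using hT'.eq_mul_div smooth' hm 0 hρ one_pos 0 ϖ

theorem IsEnstrophyDensity.contDiffOn {f : ℝ → ℝ} (hf : ContDiff ℝ ∞ f) {T : Space n × ℝ → ℝ → ℝ}
    (hT : IsEnstrophyDensity f T) :
    ContDiffOn ℝ ∞ (fun z : (Space n × ℝ) × ℝ => T z.1 z.2)
      {z | z.1 ∈ isentropicPhysical n} := by
  have quotient : ContDiffOn ℝ ∞ (fun z : (Space n × ℝ) × ℝ => z.2 / z.1.2)
      {z | z.1 ∈ isentropicPhysical n} :=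
    contDiff_snd.contDiffOn.div contDiff_fst.snd.contDiffOn fun z hz => ne_of_gt hz
  exact (contDiff_fst.snd.contDiffOn.mul (hf.comp_contDiffOn quotient)).congr fun z hz =>
    hT z.1.1 z.1.2 z.2 hz

theorem IsEnstrophyDensity.fderiv_apply {f : ℝ → ℝ} {T : Space n × ℝ → ℝ → ℝ}
    (hT : IsEnstrophyDensity f T) {u : Space n} {ρ S ϖ : ℝ} (hρ : 0 < ρ)
    (hd : DifferentiableAt ℝ (Function.uncurry fun s : Space n × ℝ × ℝ => T (s.1, s.2.1))
      ((u, ρ, S), ϖ)) (v : Space n) (τ : ℝ) :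
    fderiv ℝ (Function.uncurry fun s : Space n × ℝ × ℝ => T (s.1, s.2.1)) ((u, ρ, S), ϖ)
      ((v, -(ρ * τ), 0), -(τ * ϖ)) = -(T (u, ρ) ϖ * τ) := by
  have scale : HasDerivAt (fun t : ℝ => 1 - t * τ) (-τ) 0 := (hasDerivAt_mul_const τ).const_sub 1
  have curve : HasDerivAt (fun t : ℝ => ((u + t • v, ρ * (1 - t * τ), S), ϖ * (1 - t * τ)))
      ((v, ρ * -τ, 0), ϖ * -τ) 0 :=
    (((hasDerivAt_id' _).smul_const v |>.const_add u |>.congr_deriv (one_smul ℝ v)).prodMk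
      ((scale.const_mul ρ).prodMk (hasDerivAt_const 0 S))).prodMk (scale.const_mul ϖ)
  have chain := HasFDerivAt.comp_hasDerivAt_of_eq 0 hd.hasFDerivAt curve (by simp)
  have scaled : (fun t : ℝ => T (u, ρ) ϖ * (1 - t * τ)) =ᶠ[nhds 0]
      fun t => T (u + t • v, ρ * (1 - t * τ)) (ϖ * (1 - t * τ)) := by
    filter_upwards [scale.continuousAt.eventually_const_lt (u := 0) (by simp)] with t ht
    rw [hT u ρ ϖ hρ, hT _ _ _ (mul_pos hρ ht), mul_div_mul_right _ _ ht.ne', mul_right_comm]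
  have h := (chain.congr_of_eventuallyEq scaled).unique (scale.const_mul (T (u, ρ) ϖ))
  rwa [mul_neg, mul_neg, mul_neg, mul_comm ϖ] at h

theorem hasGradientAt_barotropic {ρ : Space n → ℝ} {x : Space n}
    (hP : DifferentiableAt ℝ P (ρ x)) (hρ : DifferentiableAt ℝ ρ x) :
    HasGradientAt (fun y => P (ρ y)) (deriv P (ρ x) • gradient ρ x) x := by
  refine HasFDerivAt.congr_fderiv (hP.hasDerivAt.comp_hasFDerivAt x hρ.hasFDerivAt) ?_
  simp [gradient]

theorem IsEnstrophyDensity.isConservedOnMovingDomains (hP : ContDiffOn ℝ ∞ P (Set.Ioi 0)) {m : ℕ}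
    {f : ℝ → ℝ} (hf : ContDiff ℝ ∞ f) {T : Space (2 * m) × ℝ → ℝ → ℝ}
    (hT : IsEnstrophyDensity f T) :
    IsConservedOnMovingDomains (isentropicPhysical (2 * m)) (isentropicRate P)
      (vorticityScalar m) T := by
  have smooth := contDiffOn_physical_of_isentropicPhysical (hT.contDiffOn hf)
  refine isConservedOnMovingDomains_isentropic_iff.2 ⟨smooth, fun q hq x => ?_⟩
  have two_le : (2 : ℕ∞ω) ≤ ∞ := WithTop.coe_le_coe.2 le_top
  have hu := hq.1.fst
  have hρ := hq.1.snd.fst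
  have ρ_pos := hq.2
  have hp : ContDiff ℝ ∞ fun y => P (q y).2.1 := hP.comp_contDiff hρ ρ_pos
  have hd : DifferentiableAt ℝ
      (Function.uncurry fun s : Space (2 * m) × ℝ × ℝ => T (s.1, s.2.1))
      (q x, scalarForm (velocityGradient (fun y => (q y).1) x)) :=
    (smooth.contDiffAt ((isOpen_physical.preimage continuous_fst).mem_nhds
      (ρ_pos x))).differentiableAt (by simp)
  have balance := timeDeriv_eulerRate_add_divergence (P := fun ρ _ => P ρ)
    vorticityScalar_eq_scalarForm scalarForm_skewPart
    (T := fun s => T (s.1, s.2.1)) rfl (hu.of_le two_le) (hρ.of_le two_le)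
    (hq.1.snd.snd.of_le two_le) (hp.of_le two_le) (ρ_pos x).ne'
    (contDiff_scalarForm.differentiable (by simp) _) hd
  have grad_p := hasGradientAt_barotropic (P := P)
    ((hP.contDiffAt (Ioi_mem_nhds (ρ_pos x))).differentiableAt (by simp))
    (hρ.differentiable (by simp) x)
  have symm_part : fderiv ℝ scalarForm (velocityGradient (fun y => (q y).1) x)
      (vecMulVec (gradient (fun y => (q y).2.1) x).ofLp
        (gradient (fun y => (q y).2.1) x).ofLp) = 0 :=
    fderiv_eq_zero_of_isSymm scalarForm_skewPart
      (contDiff_scalarForm.differentiable (by simp) _) (transpose_vecMulVec _ _)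
  refine balance.trans ?_
  rw [grad_p.gradient, WithLp.ofLp_smul, smul_vecMulVec, map_smul, symm_part, smul_zero, smul_zero,
    zero_sub, fderiv_scalarForm_mul_self, hT.fderiv_apply (ρ_pos x) hd, neg_add_cancel]

end Isentropic

/-! ### The vorticity scalar as a divergence -/

section VorticityPotential

variable {n : ℕ} {κ τ : Type*} [Fintype κ] [DecidableEq κ] [Fintype τ]

theorem fderiv_epsilonContraction_comp {E : Type*} [NormedAddCommGroup E] [NormedSpace ℝ E]
    (e : (κ ⊕ κ) ⊕ τ ≃ Fin n) (v : τ → Fin n → ℝ) {M : κ → E → Matrix (Fin n) (Fin n) ℝ} {y : E}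
    (hM : ∀ k, DifferentiableAt ℝ (M k) y) (w : E) :
    fderiv ℝ (fun z => epsilonContraction e v fun k => M k z) y w =
      ∑ k, epsilonContraction e v (Function.update (M · y) k (fderiv ℝ (M k) y w)) := by
  let Ω : ContinuousMultilinearMap ℝ (fun _ : κ => Matrix (Fin n) (Fin n) ℝ) ℝ :=
    ⟨epsilonContraction e v, (contDiff_epsilonContraction e v).continuous⟩
  have h := HasFDerivAt.multilinear_comp (f := Ω) fun k => (hM k).hasFDerivAt
  exact (congrArg (· w) h.fderiv).trans (sum_apply _ _ _)

theorem divergence_eq_sum_fderiv_apply {X : Space n → Space n} {x : Space n}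
    (hX : DifferentiableAt ℝ X x) :
    divergence X x = ∑ i, fderiv ℝ (fun y => X y i) x (EuclideanSpace.single i 1) := by
  refine Fintype.sum_congr _ _ fun i => ?_
  have h := (EuclideanSpace.proj (𝕜 := ℝ) i).hasFDerivAt.comp x hX.hasFDerivAt
  exact (congrArg (· (EuclideanSpace.single i 1)) h.fderiv).symm

theorem matrixCLM_eq_sum_vecMulVec (L : Space n →L[ℝ] Space n) :
    matrixCLM n L =
      ∑ i, vecMulVec (L (EuclideanSpace.single i 1)).ofLp (Pi.single i 1) := by
  ext i j
  simp [matrixCLM_apply, Matrix.sum_apply, vecMulVec_apply, Pi.single_apply]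

theorem matrixCLM_proj_smulRight (w : Space n) (j : Fin n) :
    matrixCLM n ((EuclideanSpace.proj j : Space n →L[ℝ] ℝ).smulRight w) =
      vecMulVec w.ofLp (Pi.single j 1) := by
  ext i l
  obtain rfl | hl := eq_or_ne l j
  · simp [matrixCLM_apply, vecMulVec_apply]
  · simp [matrixCLM_apply, vecMulVec_apply, hl]

/-- A vector potential for the contraction of `ε` with copies of the velocity gradient `A`: the
factor `k` is replaced by the velocity `u`, and its index of differentiation is left free. -/
noncomputable def vorticityPotential (e : (κ ⊕ κ) ⊕ τ ≃ Fin n) (v : τ → Fin n → ℝ) (k : κ)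
    (u : Space n) (A : Matrix (Fin n) (Fin n) ℝ) : Space n :=
  WithLp.toLp 2 fun j =>
    epsilonContraction e v (Function.update (fun _ => A) k (vecMulVec u.ofLp (Pi.single j 1)))

variable {e : (κ ⊕ κ) ⊕ τ ≃ Fin n} {v : τ → Fin n → ℝ} {u : Space n → Space n}

theorem contDiff_vorticityPotential (k : κ) :
    ContDiff ℝ ∞ fun z : Space n × Matrix (Fin n) (Fin n) ℝ =>
      vorticityPotential e v k z.1 z.2 := by
  refine contDiff_euclidean.2 fun j => (contDiff_epsilonContraction e v).comp ?_
  refine contDiff_pi.2 fun l => ?_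
  obtain rfl | hl := eq_or_ne l k
  · simp only [Function.update_self, ← matrixCLM_proj_smulRight]
    exact (matrixCLM n).contDiff.comp ((ContinuousLinearMap.smulRightL ℝ (Space n) (Space n)
        (EuclideanSpace.proj j)).contDiff.comp contDiff_fst)
  · simpa only [Function.update_of_ne hl] using contDiff_snd

theorem sum_epsilonContraction_update_update_eq_zero (hu : ContDiff ℝ 2 u) {k l : κ} (hkl : k ≠ l)
    (M : κ → Matrix (Fin n) (Fin n) ℝ) (w : Fin n → ℝ) (x : Space n) :
    ∑ j, epsilonContraction e v (Function.update (Function.update M k (vecMulVec w (Pi.single j 1)))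
      l (fderiv ℝ (velocityGradient u) x (EuclideanSpace.single j 1))) = 0 := by
  simp only [(hasFDerivAt_velocityGradient hu x).fderiv, ContinuousLinearMap.comp_apply,
    matrixCLM_eq_sum_vecMulVec, MultilinearMap.map_update_sum]
  refine self_eq_neg.1 ?_
  conv_lhs => rw [Finset.sum_comm]
  simp only [← Finset.sum_neg_distrib]
  refine Fintype.sum_congr _ _ fun i => Fintype.sum_congr _ _ fun j => ?_
  rw [epsilonContraction_update_update_vecMulVec v M hkl, fderiv_fderiv_comm hu]

theorem hasFDerivAt_vecMulVec_single {x : Space n} (hu : DifferentiableAt ℝ u x) (j : Fin n) :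
    HasFDerivAt (fun y => vecMulVec (u y).ofLp (Pi.single j (1 : ℝ)))
      ((matrixCLM n).comp ((ContinuousLinearMap.smulRightL ℝ (Space n) (Space n)
        (EuclideanSpace.proj j)).comp (fderiv ℝ u x))) x := by
  simp only [← matrixCLM_proj_smulRight]
  exact (matrixCLM n).hasFDerivAt.comp x ((ContinuousLinearMap.smulRightL ℝ (Space n) (Space n)
    (EuclideanSpace.proj j)).hasFDerivAt.comp x hu.hasFDerivAt)

theorem divergence_vorticityPotential (hu : ContDiff ℝ 2 u) (k : κ) (x : Space n) :
    divergence (fun y => vorticityPotential e v k (u y) (velocityGradient u y)) x =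
      epsilonContraction e v fun _ => velocityGradient u x := by
  let M (j : Fin n) (l : κ) (y : Space n) : Matrix (Fin n) (Fin n) ℝ :=
    Function.update (fun _ => velocityGradient u y) k (vecMulVec (u y).ofLp (Pi.single j 1)) l
  have diff_u := hu.differentiable (by simp) x
  have grad := hasFDerivAt_velocityGradient hu x
  have deriv_self (j) : HasFDerivAt (M j k) _ x :=
    (hasFDerivAt_vecMulVec_single diff_u j).congr_of_eventuallyEq
      (.of_forall fun y => Function.update_self _ _ _)
  have deriv_of_ne (j) {l : κ} (hl : l ≠ k) : HasFDerivAt (M j l) _ x :=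
    grad.congr_of_eventuallyEq (.of_forall fun y => Function.update_of_ne hl _ _)
  have diff_M (j l) : DifferentiableAt ℝ (M j l) x := by
    obtain rfl | hl := eq_or_ne l k
    exacts [(deriv_self j).differentiableAt, (deriv_of_ne j hl).differentiableAt]
  have diff : DifferentiableAt ℝ
      (fun y => vorticityPotential e v k (u y) (velocityGradient u y)) x :=
    ((contDiff_vorticityPotential k).differentiable (by simp) _).comp x
      (diff_u.prodMk grad.differentiableAt)
  rw [divergence_eq_sum_fderiv_apply diff]
  refine (Fintype.sum_congr _ _ fun j =>
    fderiv_epsilonContraction_comp e v (diff_M j) (EuclideanSpace.single j 1)).trans ?_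
  rw [Finset.sum_comm, Fintype.sum_eq_single k fun l hl => ?_]
  · simp only [(deriv_self _).fderiv, M, ContinuousLinearMap.comp_apply]
    have idem (A B C : Matrix (Fin n) (Fin n) ℝ) : Function.update (fun l : κ =>
        Function.update (fun _ => A) k B l) k C = Function.update (fun _ => A) k C :=
      Function.update_idem _ _ _
    simp only [idem, ContinuousLinearMap.smulRightL_apply_apply, matrixCLM_proj_smulRight]
    rw [← MultilinearMap.map_update_sum, ← matrixCLM_eq_sum_vecMulVec]
    exact congrArg _ (Function.update_eq_self k _)
  · simp only [(deriv_of_ne _ hl).fderiv]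
    rw [← grad.fderiv]
    exact sum_epsilonContraction_update_update_eq_zero hu hl.symm _ _ x

end VorticityPotential

section AffineEnstrophy

variable {n : ℕ}

/-- The velocity gradient as a linear function of the first derivative of a state, in the form in
which `IsSpatialDivergence` passes derivatives to the potential. -/
noncomputable def jetVelocityGradient (n : ℕ) :
    ContinuousMultilinearMap ℝ (fun _ : Fin 1 => Space n) (Space n × ℝ) →L[ℝ]
      Matrix (Fin n) (Fin n) ℝ :=
  (matrixCLM n).comp <|
    (ContinuousLinearMap.compL ℝ (Space n) (Space n × ℝ) (Space n)
      (ContinuousLinearMap.fst ℝ (Space n) ℝ)).comp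
      ((continuousMultilinearCurryFin1 ℝ (Space n) (Space n × ℝ)).toContinuousLinearEquiv :
        _ →L[ℝ] _)

theorem jetVelocityGradient_iteratedFDeriv {q : Space n → Space n × ℝ} {x : Space n}
    (hq : DifferentiableAt ℝ q x) :
    jetVelocityGradient n (iteratedFDeriv ℝ 1 q x) = velocityGradient (fun y => (q y).1) x := by
  have curry : continuousMultilinearCurryFin1 ℝ (Space n) (Space n × ℝ) (iteratedFDeriv ℝ 1 q x) =
      fderiv ℝ q x := by
    ext w <;> simp [iteratedFDeriv_one_apply]
  rw [velocityGradient, fderiv.fst hq, ← curry]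
  rfl

variable {m : ℕ} {f : ℝ → ℝ} {T : Space (2 * m) × ℝ → ℝ → ℝ}

theorem isSpatialDivergence_vorticityScalar (hm : 1 ≤ m) (a : ℝ) :
    IsSpatialDivergence (isentropicPhysical (2 * m))
      fun _ q x => a * vorticityScalar m (fun y => (q y).1) x := by
  let potential (z : Space (2 * m) × Matrix (Fin (2 * m)) (Fin (2 * m)) ℝ) : Space (2 * m) :=
    vorticityPotential (evenSlots m) ![] ⟨0, hm⟩ z.1 z.2
  have smooth : ContDiff ℝ ∞ potential := contDiff_vorticityPotential _
  let jet (z : ℝ × Space (2 * m) × (Space (2 * m) × ℝ) × ((j : Fin 1) →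
      ContinuousMultilinearMap ℝ (fun _ : Fin (j + 1) => Space (2 * m)) (Space (2 * m) × ℝ))) :
      Space (2 * m) × Matrix (Fin (2 * m)) (Fin (2 * m)) ℝ :=
    (z.2.2.1.1, jetVelocityGradient (2 * m) (z.2.2.2 0))
  have smooth_jet : ContDiff ℝ ∞ jet :=
    contDiff_snd.snd.fst.fst.prodMk
      ((jetVelocityGradient _).contDiff.comp (contDiff_pi.1 contDiff_snd.snd.snd 0))
  refine ⟨1, fun z => a • potential (jet z), ?_, fun t q hq x => ?_⟩
  · exact ((smooth.comp smooth_jet).const_smul a).contDiffOn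
  · have diff_q := hq.1.differentiable (by simp)
    have hu : ContDiff ℝ 2 fun y => (q y).1 :=
      (contDiff_fst.comp hq.1).of_le (WithTop.coe_le_coe.2 le_top)
    have jet_eq (y : Space (2 * m)) :
        jet (t, y, q y, fun j : Fin 1 => iteratedFDeriv ℝ (j + 1) q y) =
          ((q y).1, velocityGradient (fun y => (q y).1) y) :=
      Prod.ext rfl (jetVelocityGradient_iteratedFDeriv (diff_q y))
    have diff : DifferentiableAt ℝ
        (fun y => potential ((q y).1, velocityGradient (fun y => (q y).1) y)) x :=
      (smooth.differentiable (by simp) _).comp x ((hu.differentiable (by simp) x).prodMk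
        (hasFDerivAt_velocityGradient hu x).differentiableAt)
    have div_potential : divergence
        (fun y => potential ((q y).1, velocityGradient (fun y => (q y).1) y)) x =
          vorticityScalar m (fun y => (q y).1) x :=
      (divergence_vorticityPotential hu _ x).trans (vorticityScalar_eq_scalarForm _ x).symm
    simp only [jet_eq]
    rw [divergence_smul (differentiableAt_const a) diff, div_potential]
    simp

theorem IsEnstrophyDensity.isKinematicUpToDivergence_of_isAffine (hm : 1 ≤ m) (hf : IsAffine f)
    (hT : IsEnstrophyDensity f T) :
    IsKinematicUpToDivergence (isentropicPhysical (2 * m)) (vorticityScalar m) T := by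
  obtain ⟨a, b, hab⟩ := hf
  refine ⟨fun z => b * z.2.2.2, (contDiff_const.mul contDiff_snd.snd.snd).contDiffOn, ?_⟩
  obtain ⟨k, Θ, hΘ, hdiv⟩ := isSpatialDivergence_vorticityScalar hm a
  refine ⟨k, Θ, hΘ, fun t q hq x => Eq.trans ?_ (hdiv t q hq x)⟩
  have hρ : 0 < (q x).2 := hq.2 x
  change densityAt (vorticityScalar m) T q x - b * (q x).2 = _
  have density := hT (q x).1 (q x).2 (vorticityScalar m (fun y => (q y).1) x) hρ
  rw [densityAt, ← Prod.mk.eta (p := q x), density, hab]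
  field_simp
  ring

end AffineEnstrophy

/-! ### Null Lagrangians -/

section NullLagrangian

open MeasureTheory

theorem hasDerivAt_integral_of_isCompact {α G : Type*} [TopologicalSpace α] [T2Space α]
    [SecondCountableTopology α] [MeasurableSpace α] [OpensMeasurableSpace α] {μ : Measure α}
    [IsFiniteMeasureOnCompacts μ] [NormedAddCommGroup G] [NormedSpace ℝ G] {F F' : ℝ → α → G}
    {t₀ : ℝ} {K : Set α} (hF : ∀ t x, HasDerivAt (F · x) (F' t x) t)
    (hFc : ∀ t, Continuous (F t)) (hF' : Continuous fun p : ℝ × α => F' p.1 p.2)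
    (hF₀ : Integrable (F t₀) μ) (hK : IsCompact K) (hsupp : ∀ t, ∀ x ∉ K, F' t x = 0) :
    HasDerivAt (fun t => ∫ x, F t x ∂μ) (∫ x, F' t₀ x ∂μ) t₀ := by
  obtain ⟨C, hC⟩ := ((isCompact_Icc (a := t₀ - 1)
    (b := t₀ + 1)).prod hK).exists_bound_of_continuousOn hF'.continuousOn
  refine (hasDerivAt_integral_of_dominated_loc_of_deriv_le (bound := K.indicator fun _ => C)
    (Icc_mem_nhds (sub_one_lt t₀) (lt_add_one t₀))
    (.of_forall fun t => (hFc t).aestronglyMeasurable) hF₀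
    (hF'.comp (Continuous.prodMk_right t₀)).aestronglyMeasurable
    (.of_forall fun x t ht => ?_) ?_ (.of_forall fun x t _ => hF t x)).2
  · by_cases hx : x ∈ K
    · rw [Set.indicator_of_mem hx]
      exact hC (t, x) ⟨ht, hx⟩
    · rw [Set.indicator_of_notMem hx, hsupp t x hx, norm_zero]
  · exact (integrable_indicator_iff hK.measurableSet).2
      (integrableOn_const hK.measure_lt_top.ne)

variable {E : Type*} [NormedAddCommGroup E] [NormedSpace ℝ E]

/-- The arguments of a Lagrangian that depends on the position, the value of a function and its
derivative in the direction `e`. -/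
noncomputable def directionalJet (e : E) (h : E → ℝ) (x : E) : E × ℝ × ℝ :=
  (x, h x, fderiv ℝ h x e)

/-- The functional `∫ Λ(x, h, ∂_e h) dμ` does not change under compactly supported variations
of `h`. -/
def IsNullLagrangian [MeasurableSpace E] (μ : Measure E) (e : E) (Λ : E × ℝ × ℝ → ℝ) : Prop :=
  ∀ h φ : E → ℝ, ContDiff ℝ ∞ h → ContDiff ℝ ∞ φ → HasCompactSupport φ →
    ∫ x, (Λ (directionalJet e (h + φ) x) - Λ (directionalJet e h x)) ∂μ = 0

variable {e : E} {h φ : E → ℝ} {Λ : E × ℝ × ℝ → ℝ}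

theorem contDiff_fderiv_apply (hφ : ContDiff ℝ ∞ φ) (e : E) :
    ContDiff ℝ ∞ fun x => fderiv ℝ φ x e :=
  (hφ.fderiv_right (by simp)).clm_apply contDiff_const

theorem contDiff_directionalJet (hh : ContDiff ℝ ∞ h) (e : E) :
    ContDiff ℝ ∞ (directionalJet e h) :=
  contDiff_id.prodMk (hh.prodMk (contDiff_fderiv_apply hh e))

theorem directionalJet_add_smul {x : E} (hh : DifferentiableAt ℝ h x)
    (hφ : DifferentiableAt ℝ φ x) (e : E) (t : ℝ) :
    directionalJet e (h + t • φ) x = directionalJet e h x + t • (0, φ x, fderiv ℝ φ x e) := by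
  simp [directionalJet, fderiv_add hh (hφ.const_smul t), fderiv_const_smul hφ]

variable [MeasurableSpace E] [BorelSpace E] [FiniteDimensional ℝ E] {μ : Measure E}

theorem IsNullLagrangian.integral_fderiv_eq_zero [IsFiniteMeasureOnCompacts μ]
    (hnull : IsNullLagrangian μ e Λ) (hΛ : ContDiff ℝ 1 Λ) (hh : ContDiff ℝ ∞ h)
    (hφ : ContDiff ℝ ∞ φ) (hc : HasCompactSupport φ) :
    ∫ x, fderiv ℝ Λ (directionalJet e h x) (0, φ x, fderiv ℝ φ x e) ∂μ = 0 := by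
  let v (x : E) : E × ℝ × ℝ := (0, φ x, fderiv ℝ φ x e)
  have cont_v : Continuous v :=
    continuous_const.prodMk (hφ.continuous.prodMk (contDiff_fderiv_apply hφ e).continuous)
  have cont_jet := (contDiff_directionalJet hh e).continuous
  have cont_Λ := hΛ.continuous
  have := hΛ.continuous_fderiv one_ne_zero
  have variation_eq_zero (t : ℝ) :
      ∫ x, (Λ (directionalJet e h x + t • v x) - Λ (directionalJet e h x)) ∂μ = 0 := by
    rw [← hnull h (t • φ) hh (hφ.const_smul t) (hc.smul_left (f := fun _ => t))]
    simp only [v, directionalJet_add_smul (hh.differentiable (by simp) _)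
      (hφ.differentiable (by simp) _)]
  have variation := hasDerivAt_integral_of_isCompact (μ := μ) (t₀ := 0) (K := tsupport φ)
    (F := fun t x => Λ (directionalJet e h x + t • v x) - Λ (directionalJet e h x))
    (F' := fun t x => fderiv ℝ Λ (directionalJet e h x + t • v x) (v x))
    (fun t x => ?_) (fun t => by fun_prop) (by fun_prop) (by simp) hc fun t x hx => ?_
  · simp only [variation_eq_zero, zero_smul, add_zero] at variation
    exact variation.unique (hasDerivAt_const 0 0)
  · have line : HasDerivAt (fun t : ℝ => directionalJet e h x + t • v x) (v x) t := by
      simpa using ((hasDerivAt_id t).smul_const (v x)).const_add (directionalJet e h x)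
    exact ((hΛ.differentiable one_ne_zero _).hasFDerivAt.comp_hasDerivAt t line).sub_const _
  · have : v x = 0 := by
      simp [v, fderiv_of_notMem_tsupport ℝ hx, image_eq_zero_of_notMem_tsupport hx]
    rw [this, map_zero]

theorem fderiv_apply_eq_of_forall_integral_eq_zero [μ.IsAddHaarMeasure] {p g : E → ℝ}
    (hp : ContDiff ℝ 1 p) (hg : Continuous g)
    (hweak : ∀ φ : E → ℝ, ContDiff ℝ ∞ φ → HasCompactSupport φ →
      ∫ y, (g y * φ y + p y * fderiv ℝ φ y e) ∂μ = 0) (x : E) :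
    fderiv ℝ p x e = g x := by
  have cont_dp : Continuous fun y => fderiv ℝ p y e :=
    (hp.continuous_fderiv one_ne_zero).clm_apply continuous_const
  refine (sub_eq_zero.1 (congrFun ((hg.sub cont_dp).ae_eq_iff_eq (μ := μ) continuous_const |>.1
    (ae_eq_zero_of_integral_contDiff_smul_eq_zero (hg.sub cont_dp).locallyIntegrable
      fun φ hφ hc => ?_)) x)).symm
  have int_p : Integrable (fun y => p y * fderiv ℝ φ y e) μ :=
    (hp.continuous.mul (contDiff_fderiv_apply hφ e).continuous).integrable_of_hasCompactSupport
      (hc.fderiv_apply (𝕜 := ℝ) (v := e)).mul_left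
  have int_dp : Integrable (fun y => fderiv ℝ p y e * φ y) μ :=
    (cont_dp.mul hφ.continuous).integrable_of_hasCompactSupport hc.mul_left
  have int_g : Integrable (fun y => g y * φ y) μ :=
    (hg.mul hφ.continuous).integrable_of_hasCompactSupport hc.mul_left
  have by_parts := integral_mul_fderiv_eq_neg_fderiv_mul_of_integrable int_dp int_p
    ((hp.continuous.mul hφ.continuous).integrable_of_hasCompactSupport hc.mul_left)
    (fun y _ => hp.differentiable one_ne_zero y) (fun y _ => hφ.differentiable (by simp) y)
  have weak := hweak φ hφ hc
  rw [integral_add int_g int_p, by_parts, ← sub_eq_add_neg, ← integral_sub int_g int_dp] at weak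
  simpa only [smul_eq_mul, Pi.sub_apply, mul_comm (φ _), sub_mul] using weak

theorem IsNullLagrangian.euler_lagrange [μ.IsAddHaarMeasure]
    (hnull : IsNullLagrangian μ e Λ) (hΛ : ContDiff ℝ 2 Λ) (hh : ContDiff ℝ ∞ h) (x : E) :
    fderiv ℝ (fun y => fderiv ℝ Λ (directionalJet e h y) (0, 0, 1)) x e =
      fderiv ℝ Λ (directionalJet e h x) (0, 1, 0) := by
  have smooth_dΛ : ContDiff ℝ 1 fun y => fderiv ℝ Λ (directionalJet e h y) :=
    (hΛ.fderiv_right (m := 1) (by norm_num)).comp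
      ((contDiff_directionalJet hh e).of_le (WithTop.coe_le_coe.2 le_top))
  refine fderiv_apply_eq_of_forall_integral_eq_zero (μ := μ)
    (g := fun y => fderiv ℝ Λ (directionalJet e h y) (0, 1, 0))
    (smooth_dΛ.clm_apply contDiff_const) (smooth_dΛ.clm_apply contDiff_const).continuous
    (fun φ hφ hc => ?_) x
  refine Eq.trans (integral_congr_ae (.of_forall fun y => ?_))
    (hnull.integral_fderiv_eq_zero (hΛ.of_le (by norm_num)) hh hφ hc)
  have split : ((0, φ y, fderiv ℝ φ y e) : E × ℝ × ℝ) =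
      φ y • (0, 1, 0) + fderiv ℝ φ y e • (0, 0, 1) := by simp
  simp only [split, map_add, map_smul, smul_eq_mul, mul_comm]

theorem isAffine_of_deriv_deriv_eq_zero {f : ℝ → ℝ} (hf : Differentiable ℝ f)
    (hf' : Differentiable ℝ (deriv f)) (h : ∀ a, deriv (deriv f) a = 0) : IsAffine f := by
  have deriv_eq (s) : deriv f s = deriv f 0 := is_const_of_deriv_eq_zero hf' h s 0
  have deriv_remainder (s) : HasDerivAt (fun s => f s - deriv f 0 * s) 0 s := by
    simpa [deriv_eq s] using (hf s).hasDerivAt.fun_sub ((hasDerivAt_id' s).const_mul (deriv f 0))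
  refine ⟨deriv f 0, f 0, fun s => ?_⟩
  have remainder := is_const_of_deriv_eq_zero (fun s => (deriv_remainder s).differentiableAt)
    (fun s => (deriv_remainder s).deriv) s 0
  simp only [mul_zero, sub_zero] at remainder
  linarith

theorem IsNullLagrangian.fderiv_fderiv_eq_zero [μ.IsAddHaarMeasure] (he : e ≠ 0)
    (hnull : IsNullLagrangian μ e Λ) (hΛ : ContDiff ℝ 2 Λ) (x : E) (z a : ℝ) :
    fderiv ℝ (fun w => fderiv ℝ Λ w (0, 0, 1)) (x, z, a) (0, 0, 1) = 0 := by
  obtain ⟨l, hl⟩ := SeparatingDual.exists_eq_one (R := ℝ) he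
  let test (c : ℝ) (y : E) : ℝ := z + a * l (y - x) + c * l (y - x) ^ 2
  have smooth_test (c) : ContDiff ℝ ∞ (test c) := by fun_prop
  have fderiv_test (c y) : fderiv ℝ (test c) y e = a + 2 * c * l (y - x) := by
    have inner : HasFDerivAt (fun y => l (y - x)) l y :=
      l.hasFDerivAt.comp y ((hasFDerivAt_id y).sub_const x)
    have outer := ((inner.const_mul a).const_add z).fun_add ((inner.pow 2).const_mul c)
    rw [outer.fderiv]
    simp only [map_sub, Nat.add_one_sub_one, pow_one, nsmul_eq_mul, Nat.cast_ofNat,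
      _root_.add_apply, _root_.smul_apply, hl, smul_eq_mul, mul_one, add_right_inj]
    ring
  have jet_test (c) : directionalJet e (test c) x = (x, z, a) := by
    rw [directionalJet, fderiv_test]
    simp [test]
  have fderiv_jet (c) : fderiv ℝ (directionalJet e (test c)) x e = (e, a, 2 * c) := by
    have slope : HasFDerivAt (fun y => fderiv ℝ (test c) y e) ((2 * c) • l) x := by
      simp only [fderiv_test]
      exact ((l.hasFDerivAt.comp x ((hasFDerivAt_id x).sub_const x)).const_mul _).const_add a
    have jet := (hasFDerivAt_id x).prodMk
      (((smooth_test c).differentiable (by simp) x).hasFDerivAt.prodMk slope)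
    refine (congrArg (· e) jet.fderiv).trans ?_
    simp [fderiv_test, hl]
  have smooth_momentum : ContDiff ℝ 1 fun w => fderiv ℝ Λ w (0, 0, 1) :=
    (hΛ.fderiv_right (by norm_num)).clm_apply contDiff_const
  have euler_lagrange (c) : fderiv ℝ (fun w => fderiv ℝ Λ w (0, 0, 1)) (x, z, a) (e, a, 2 * c) =
      fderiv ℝ Λ (x, z, a) (0, 1, 0) := by
    have chain := fderiv_comp x (smooth_momentum.differentiable one_ne_zero _)
      ((contDiff_directionalJet (smooth_test c) e).differentiable (by simp) x)
    rw [← fderiv_jet, ← jet_test c, ← hnull.euler_lagrange hΛ (smooth_test c)]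
    exact (congrArg (· e) chain).symm
  have h := (euler_lagrange (1 / 2)).trans (euler_lagrange 0).symm
  rw [← sub_eq_zero, ← map_sub] at h
  simpa using h

theorem IsNullLagrangian.isAffine [μ.IsAddHaarMeasure] (he : e ≠ 0)
    (hnull : IsNullLagrangian μ e Λ) (hΛ : ContDiff ℝ 2 Λ) (x : E) (z : ℝ) :
    IsAffine fun a => Λ (x, z, a) := by
  have line (a : ℝ) : HasDerivAt (fun a => (x, z, a)) ((0, 0, 1) : E × ℝ × ℝ) a :=
    (hasDerivAt_const a x).prodMk ((hasDerivAt_const a z).prodMk (hasDerivAt_id a))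
  have momentum (a) : HasDerivAt (fun a => Λ (x, z, a)) (fderiv ℝ Λ (x, z, a) (0, 0, 1)) a :=
    (hΛ.differentiable two_ne_zero _).hasFDerivAt.comp_hasDerivAt a (line a)
  have smooth_momentum : ContDiff ℝ 1 fun w => fderiv ℝ Λ w (0, 0, 1) :=
    (hΛ.fderiv_right (by norm_num)).clm_apply contDiff_const
  have deriv_momentum (a) : HasDerivAt (deriv fun a => Λ (x, z, a)) 0 a := by
    rw [funext fun a => (momentum a).deriv]
    exact ((smooth_momentum.differentiable one_ne_zero _).hasFDerivAt.comp_hasDerivAt a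
      (line a)).congr_deriv (hnull.fderiv_fderiv_eq_zero he hΛ x z a)
  exact isAffine_of_deriv_deriv_eq_zero (fun a => (momentum a).differentiableAt)
    (fun a => (deriv_momentum a).differentiableAt) fun a => (deriv_momentum a).deriv

end NullLagrangian

section KinematicEnstrophy

open MeasureTheory

variable {n : ℕ}

theorem integral_fderiv_apply_eq_zero {E : Type*} [NormedAddCommGroup E] [NormedSpace ℝ E]
    [FiniteDimensional ℝ E] [MeasurableSpace E] [BorelSpace E] {μ : Measure E}
    [μ.IsAddHaarMeasure] {φ : E → ℝ} (hφ : ContDiff ℝ 1 φ) (hc : HasCompactSupport φ) (e : E) :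
    ∫ x, fderiv ℝ φ x e ∂μ = 0 := by
  have cont : Continuous fun x => fderiv ℝ φ x e :=
    (hφ.continuous_fderiv one_ne_zero).clm_apply continuous_const
  have by_parts := integral_mul_fderiv_eq_neg_fderiv_mul_of_integrable (μ := μ)
    (f := fun _ : E => (1 : ℝ)) (g := φ) (v := e) (by simp)
    (by simpa using cont.integrable_of_hasCompactSupport (hc.fderiv_apply (𝕜 := ℝ) (v := e)))
    (by simpa using hφ.continuous.integrable_of_hasCompactSupport hc)
    (fun x _ => differentiableAt_const _) fun x _ => hφ.differentiable one_ne_zero x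
  simpa using by_parts

theorem integral_divergence_eq_zero {X : Space n → Space n} (hX : ContDiff ℝ 1 X)
    (hc : HasCompactSupport X) : ∫ x, divergence X x = 0 := by
  have smooth_coord (i) : ContDiff ℝ 1 fun x => X x i := contDiff_euclidean.1 hX i
  have compact_coord (i) : HasCompactSupport fun x => X x i :=
    hc.comp_left (g := fun v : Space n => v i) rfl
  simp only [divergence_eq_sum_fderiv_apply (hX.differentiable one_ne_zero _)]
  rw [integral_finsetSum _ fun i _ => ?_]
  · exact Finset.sum_eq_zero fun i _ =>
      integral_fderiv_apply_eq_zero (smooth_coord i) (compact_coord i) _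
  · exact (((smooth_coord i).continuous_fderiv one_ne_zero).clm_apply
      continuous_const).integrable_of_hasCompactSupport
        ((compact_coord i).fderiv_apply (𝕜 := ℝ) (v := EuclideanSpace.single i 1))

theorem divergence_sub {X Y : Space n → Space n} {x : Space n} (hX : DifferentiableAt ℝ X x)
    (hY : DifferentiableAt ℝ Y x) : divergence (X - Y) x = divergence X x - divergence Y x := by
  simp [divergence, partialDeriv, fderiv_sub hX hY]

theorem IsSpatialDivergence.integral_sub_eq_zero {F : Type*} [NormedAddCommGroup F]
    [NormedSpace ℝ F] {Ω : Set F} {L : ℝ → (Space n → F) → Space n → ℝ}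
    (hL : IsSpatialDivergence Ω L) (t : ℝ) {q q' : Space n → F} (hq : IsSmoothField Ω q)
    (hq' : IsSmoothField Ω q') {K : Set (Space n)} (hK : IsCompact K)
    (hqq' : Set.EqOn q q' Kᶜ) : ∫ x, (L t q x - L t q' x) = 0 := by
  obtain ⟨k, Θ, hΘ, hdiv⟩ := hL
  let flux (q : Space n → F) (y : Space n) : Space n :=
    Θ (t, y, q y, fun j : Fin k => iteratedFDeriv ℝ (j + 1) q y)
  have smooth_flux {q} (hq : IsSmoothField Ω q) : ContDiff ℝ 1 (flux q) := by
    refine ContDiff.of_le (hΘ.comp_contDiff (contDiff_const.prodMk (contDiff_id.prodMk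
      (hq.1.prodMk (contDiff_pi.2 fun j => ?_)))) hq.2) (WithTop.coe_le_coe.2 le_top)
    exact hq.1.iteratedFDeriv_right
      (WithTop.coe_le_coe.2 (le_top : (⊤ + ((j + 1 : ℕ) : ℕ∞) : ℕ∞) ≤ ⊤))
  have div_sub (x) : L t q x - L t q' x = divergence (flux q - flux q') x := by
    rw [divergence_sub ((smooth_flux hq).differentiable one_ne_zero x)
      ((smooth_flux hq').differentiable one_ne_zero x), hdiv t q hq, hdiv t q' hq']
  simp only [div_sub]
  refine integral_divergence_eq_zero ((smooth_flux hq).sub (smooth_flux hq'))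
    (HasCompactSupport.intro hK fun x hx => ?_)
  have near : q =ᶠ[nhds x] q' :=
    Filter.eventually_of_mem (hK.isClosed.isOpen_compl.mem_nhds hx) hqq'
  have jet (j : Fin k) : iteratedFDeriv ℝ (j + 1) q x = iteratedFDeriv ℝ (j + 1) q' x :=
    (near.iteratedFDeriv ℝ (j + 1)).eq_of_nhds
  simp only [Pi.sub_apply, flux, jet, hqq' hx, sub_self]

theorem velocityGradient_linear_add_smul_single (A : Matrix (Fin n) (Fin n) ℝ)
    {h : Space n → ℝ} {x : Space n} (hh : DifferentiableAt ℝ h x) (i : Fin n) :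
    velocityGradient (fun y => toEuclideanCLM (𝕜 := ℝ) A y + h y • EuclideanSpace.single i 1) x =
      A + vecMulVec (Pi.single i 1) (gradient h x).ofLp := by
  have deriv := (toEuclideanCLM (𝕜 := ℝ) A).hasFDerivAt.fun_add
    (hh.hasFDerivAt.smul_const (EuclideanSpace.single i (1 : ℝ)))
  rw [velocityGradient, deriv.fderiv, map_add, matrixCLM_smulRight]
  exact congrArg (· + _) ((toEuclideanCLM (n := Fin n) (𝕜 := ℝ)).symm_apply_apply A)

variable {m : ℕ} {f : ℝ → ℝ} {T : Space (2 * m) × ℝ → ℝ → ℝ} {h : Space (2 * m) → ℝ}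

/-- The state of unit density with a unit shear flow in each of `m` orthogonal planes, the one in
the `k`-th plane perturbed by the profile `h`; it serves as a test field of prescribed vorticity. -/
noncomputable def perturbedShear (k : Fin m) (h : Space (2 * m) → ℝ) (y : Space (2 * m)) :
    Space (2 * m) × ℝ :=
  (toEuclideanCLM (𝕜 := ℝ) (pairMatrix ℝ (evenSlots m)) y +
    h y • EuclideanSpace.single (evenSlots m (.inl (.inl k))) 1, 1)

theorem isSmoothField_perturbedShear (k : Fin m) (hh : ContDiff ℝ ∞ h) :
    IsSmoothField (isentropicPhysical (2 * m)) (perturbedShear k h) :=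
  ⟨((ContinuousLinearMap.contDiff _).add (hh.smul contDiff_const)).prodMk contDiff_const,
    fun _ => one_pos (α := ℝ)⟩

theorem vorticityScalar_perturbedShear (k : Fin m) {x : Space (2 * m)}
    (hh : DifferentiableAt ℝ h x) :
    vorticityScalar m (fun y => (perturbedShear k h y).1) x =
      (1 + fderiv ℝ h x (EuclideanSpace.single (evenSlots m (.inl (.inr k))) 1)) *
        m.factorial := by
  rw [vorticityScalar_eq_scalarForm, ← gradient_apply, ← scalarForm_pairMatrix_add]
  exact congrArg _ (velocityGradient_linear_add_smul_single _ hh _)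

theorem IsEnstrophyDensity.densityAt_perturbedShear (hT : IsEnstrophyDensity f T) (k : Fin m)
    {x : Space (2 * m)} (hh : DifferentiableAt ℝ h x) :
    densityAt (vorticityScalar m) T (perturbedShear k h) x =
      f ((1 + fderiv ℝ h x (EuclideanSpace.single (evenSlots m (.inl (.inr k))) 1)) *
        m.factorial) := by
  rw [densityAt, vorticityScalar_perturbedShear k hh]
  exact (hT _ 1 _ one_pos).trans (by rw [one_mul, div_one])

theorem IsEnstrophyDensity.exists_isNullLagrangian (hT : IsEnstrophyDensity f T)
    (hkin : IsKinematicUpToDivergence (isentropicPhysical (2 * m)) (vorticityScalar m) T)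
    (k : Fin m) :
    ∃ g : Space (2 * m) × ℝ → ℝ, ContDiff ℝ ∞ g ∧
      IsNullLagrangian volume (EuclideanSpace.single (evenSlots m (.inl (.inr k))) 1)
        fun z => f ((1 + z.2.2) * m.factorial) - g (z.1, z.2.1) := by
  obtain ⟨K, hK, hdiv⟩ := hkin
  refine ⟨fun z => K (0, z.1, perturbedShear k (fun _ => z.2) z.1), ?_, fun h φ hh hφ hc => ?_⟩
  · refine hK.comp_contDiff (contDiff_const.prodMk (contDiff_fst.prodMk (ContDiff.prodMk ?_
      contDiff_const))) fun _ => one_pos (α := ℝ)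
    exact ((ContinuousLinearMap.contDiff _).comp contDiff_fst).add
      (contDiff_snd.smul contDiff_const)
  · have diff_h := hh.differentiable (by simp)
    have diff_sum := (hh.add hφ).differentiable (by simp)
    have balance := hdiv.integral_sub_eq_zero 0 (isSmoothField_perturbedShear k (hh.add hφ))
      (isSmoothField_perturbedShear k hh) hc fun x hx => by
        simp [perturbedShear, image_eq_zero_of_notMem_tsupport hx]
    simp only [hT.densityAt_perturbedShear k (diff_h _),
      hT.densityAt_perturbedShear k (diff_sum _)] at balance
    exact balance

theorem IsEnstrophyDensity.isAffine (hm : 1 ≤ m) (hf : ContDiff ℝ ∞ f)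
    (hT : IsEnstrophyDensity f T)
    (hkin : IsKinematicUpToDivergence (isentropicPhysical (2 * m)) (vorticityScalar m) T) :
    IsAffine f := by
  obtain ⟨g, hg, hnull⟩ := hT.exists_isNullLagrangian hkin ⟨0, hm⟩
  have smooth : ContDiff ℝ 2 fun z : Space (2 * m) × ℝ × ℝ =>
      f ((1 + z.2.2) * m.factorial) - g (z.1, z.2.1) :=
    ContDiff.of_le (by fun_prop) (WithTop.coe_le_coe.2 le_top)
  obtain ⟨a, b, hab⟩ := hnull.isAffine (by simp) smooth 0 0
  have factorial_ne_zero : (m.factorial : ℝ) ≠ 0 := by positivity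
  refine ⟨a / m.factorial, b - a + g (0, 0), fun s => ?_⟩
  have value := hab (s / m.factorial - 1)
  simp only [add_sub_cancel, div_mul_cancel₀ _ factorial_ne_zero] at value
  linear_combination value

end KinematicEnstrophy

/-! ### Classification -/

section Classification

variable {n : ℕ} {G V : Type*} [NormedAddCommGroup G] [NormedSpace ℝ G] [NormedAddCommGroup V]
  [NormedSpace ℝ V] {vort : (Space n → Space n) → Space n → V}

theorem IsVorticityIndependent.isKinematicUpToDivergence {Ω : Set (Space n × G)}
    {T : Space n × G → V → ℝ}
    (hT : ContDiffOn ℝ ∞ (fun z : (Space n × G) × V => T z.1 z.2) {z | z.1 ∈ Ω})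
    (hind : IsVorticityIndependent Ω T) : IsKinematicUpToDivergence Ω vort T := by
  refine ⟨fun z => T z.2.2 0, ?_, 0, 0, contDiffOn_const, fun t q hq x => ?_⟩
  · exact hT.comp (contDiff_snd.snd.prodMk contDiff_const).contDiffOn fun z hz => hz
  · simp [densityAt, hind _ (hq.2 x) _ 0, divergence, partialDeriv]

theorem not_exists_isVorticityConstantOfMotion {Ω : Set (Space n × G)}
    {rate : (Space n → Space n × G) → Space n → Space n × G}
    (h : ∀ T, IsConservedOnMovingDomains Ω rate vort T → IsVorticityIndependent Ω T) :
    ¬ ∃ T, IsVorticityConstantOfMotion Ω rate vort T :=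
  fun ⟨T, hT, nontrivial⟩ => nontrivial ((h T hT).isKinematicUpToDivergence hT.1)

variable {P : ℝ → ℝ} {m : ℕ} {T : Space (2 * m) × ℝ → ℝ → ℝ}

theorem isConservedOnMovingDomains_iff_exists_isEnstrophyDensity (hP : IsIsentropicEOS P)
    (hm : 1 ≤ m) :
    IsConservedOnMovingDomains (isentropicPhysical (2 * m)) (isentropicRate P)
        (vorticityScalar m) T ↔
      ∃ f : ℝ → ℝ, ContDiff ℝ ∞ f ∧ IsEnstrophyDensity f T :=
  ⟨fun hT => hT.exists_isEnstrophyDensity hP hm,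
    fun ⟨_, hf, hT⟩ => hT.isConservedOnMovingDomains hP.1 hf⟩

theorem isVorticityConstantOfMotion_iff_exists_isEnstrophyDensity (hP : IsIsentropicEOS P)
    (hm : 1 ≤ m) :
    IsVorticityConstantOfMotion (isentropicPhysical (2 * m)) (isentropicRate P)
        (vorticityScalar m) T ↔
      ∃ f : ℝ → ℝ, ContDiff ℝ ∞ f ∧ ¬ IsAffine f ∧ IsEnstrophyDensity f T := by
  rw [IsVorticityConstantOfMotion, isConservedOnMovingDomains_iff_exists_isEnstrophyDensity hP hm]
  constructor
  · rintro ⟨⟨f, hf, hT⟩, nontrivial⟩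
    exact ⟨f, hf, fun h => nontrivial (hT.isKinematicUpToDivergence_of_isAffine hm h), hT⟩
  · rintro ⟨f, hf, nonaffine, hT⟩
    exact ⟨⟨f, hf, hT⟩, fun h => nonaffine (hT.isAffine hm hf h)⟩

end Classification

end CompressibleFlow

theorem proposition2_general (m : ℕ) (hm : 1 ≤ m) :
    (∀ P : ℝ → ℝ → ℝ, IsNonIsentropicEOS P →
      (¬ ∃ T : Space (2 * m) × ℝ × ℝ → ℝ → ℝ,
          IsVorticityConstantOfMotion (physical (2 * m)) (eulerRate P) (vorticityScalar m) T) ∧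
        (∀ T : Space (2 * m) × ℝ × ℝ → ℝ → ℝ,
          IsConservedOnMovingDomains (physical (2 * m)) (eulerRate P) (vorticityScalar m) T →
          IsVorticityIndependent (physical (2 * m)) T)) ∧
    (∀ P : ℝ → ℝ → ℝ, ContDiffOn ℝ ∞ (fun z : ℝ × ℝ => P z.1 z.2) {z | 0 < z.1} →
      (¬ ∃ T : Space (2 * m + 1) × ℝ × ℝ → Space (2 * m + 1) → ℝ,
          IsVorticityConstantOfMotion (physical (2 * m + 1)) (eulerRate P)
            (vorticityVector m) T) ∧
        (∀ T : Space (2 * m + 1) × ℝ × ℝ → Space (2 * m + 1) → ℝ,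
          IsConservedOnMovingDomains (physical (2 * m + 1)) (eulerRate P) (vorticityVector m) T →
          IsVorticityIndependent (physical (2 * m + 1)) T)) ∧
    (∀ P : ℝ → ℝ, IsIsentropicEOS P → ∀ T : Space (2 * m) × ℝ → ℝ → ℝ,
      (IsVorticityConstantOfMotion (isentropicPhysical (2 * m)) (isentropicRate P)
          (vorticityScalar m) T ↔
        ∃ f : ℝ → ℝ, ContDiff ℝ ∞ f ∧ ¬ IsAffine f ∧ IsEnstrophyDensity f T) ∧
      (IsConservedOnMovingDomains (isentropicPhysical (2 * m)) (isentropicRate P)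
          (vorticityScalar m) T ↔
        ∃ f : ℝ → ℝ, ContDiff ℝ ∞ f ∧ IsEnstrophyDensity f T)) ∧
    (∀ P : ℝ → ℝ, ContDiffOn ℝ ∞ P (Set.Ioi 0) →
      (¬ ∃ T : Space (2 * m + 1) × ℝ → Space (2 * m + 1) → ℝ,
          IsVorticityConstantOfMotion (isentropicPhysical (2 * m + 1)) (isentropicRate P)
            (vorticityVector m) T) ∧
        (∀ T : Space (2 * m + 1) × ℝ → Space (2 * m + 1) → ℝ,
          IsConservedOnMovingDomains (isentropicPhysical (2 * m + 1)) (isentropicRate P)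
            (vorticityVector m) T →
          IsVorticityIndependent (isentropicPhysical (2 * m + 1)) T)) := by
  refine ⟨fun P hP => ?_, fun P hP => ?_, fun P hP T => ?_, fun P hP => ?_⟩
  · have independent {T} := IsConservedOnMovingDomains.isVorticityIndependent_of_even hP hm (T := T)
    exact ⟨not_exists_isVorticityConstantOfMotion fun _ => independent, fun _ => independent⟩
  · have independent {T} := IsConservedOnMovingDomains.isVorticityIndependent_of_odd hP hm (T := T)
    exact ⟨not_exists_isVorticityConstantOfMotion fun _ => independent, fun _ => independent⟩
  · exact ⟨isVorticityConstantOfMotion_iff_exists_isEnstrophyDensity hP hm,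
      isConservedOnMovingDomains_iff_exists_isEnstrophyDensity hP hm⟩
  · have independent {T} :=
      IsConservedOnMovingDomains.isVorticityIndependent_of_odd_isentropic hP hm (T := T)
    exact ⟨not_exists_isVorticityConstantOfMotion fun _ => independent, fun _ => independent⟩

theorem proposition2 :
    -- non-isentropic equations of state, in even and in odd dimensions
    (∀ P : ℝ → ℝ → ℝ, IsNonIsentropicEOS P → ∀ m : ℕ, 1 ≤ m →
      ((¬ ∃ T : Space (2 * m) × ℝ × ℝ → ℝ → ℝ,
          IsVorticityConstantOfMotion (physical (2 * m)) (eulerRate P) (vorticityScalar m) T) ∧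
        (∀ T : Space (2 * m) × ℝ × ℝ → ℝ → ℝ,
          IsConservedOnMovingDomains (physical (2 * m)) (eulerRate P) (vorticityScalar m) T →
          IsVorticityIndependent (physical (2 * m)) T)) ∧
      ((¬ ∃ T : Space (2 * m + 1) × ℝ × ℝ → Space (2 * m + 1) → ℝ,
          IsVorticityConstantOfMotion (physical (2 * m + 1)) (eulerRate P)
            (vorticityVector m) T) ∧
        (∀ T : Space (2 * m + 1) × ℝ × ℝ → Space (2 * m + 1) → ℝ,
          IsConservedOnMovingDomains (physical (2 * m + 1)) (eulerRate P) (vorticityVector m) T →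
          IsVorticityIndependent (physical (2 * m + 1)) T))) ∧
    -- isentropic equations of state, in even and in odd dimensions
    (∀ P : ℝ → ℝ, IsIsentropicEOS P → ∀ m : ℕ, 1 ≤ m →
      (∀ T : Space (2 * m) × ℝ → ℝ → ℝ,
        (IsVorticityConstantOfMotion (isentropicPhysical (2 * m)) (isentropicRate P)
            (vorticityScalar m) T ↔
          ∃ f : ℝ → ℝ, ContDiff ℝ ∞ f ∧ ¬ IsAffine f ∧ IsEnstrophyDensity f T) ∧
        (IsConservedOnMovingDomains (isentropicPhysical (2 * m)) (isentropicRate P)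
            (vorticityScalar m) T ↔
          ∃ f : ℝ → ℝ, ContDiff ℝ ∞ f ∧ IsEnstrophyDensity f T)) ∧
      ((¬ ∃ T : Space (2 * m + 1) × ℝ → Space (2 * m + 1) → ℝ,
          IsVorticityConstantOfMotion (isentropicPhysical (2 * m + 1)) (isentropicRate P)
            (vorticityVector m) T) ∧
        (∀ T : Space (2 * m + 1) × ℝ → Space (2 * m + 1) → ℝ,
          IsConservedOnMovingDomains (isentropicPhysical (2 * m + 1)) (isentropicRate P)
            (vorticityVector m) T →
          IsVorticityIndependent (isentropicPhysical (2 * m + 1)) T))) :=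
  ⟨fun P hP m hm => have h := proposition2_general m hm; ⟨h.1 P hP, h.2.1 P hP.1⟩,
    fun P hP m hm => have h := proposition2_general m hm; ⟨h.2.2.1 P hP, h.2.2.2 P hP.1⟩⟩
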